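/- **Signatures and structures.** A signature $\Omega$ consists of function symbols $f$ and real-valued relation symbols $R$ with finite arities (constants are the $0$-ary function symbols), together with, for each symbol $S$, a positive rational $\delta(S,N,\varepsilon)$ for every positive integer $N$ and positive rational $\varepsilon$, and an integer $K(S,N)$ for every integer $N$. A *normed space structure* (of signature $\Omega$) is a real normed space $E$ with functions $f^E:E^m\to E$ and $R^E:E^m\to\mathbb R$ such that, for $S=f$ or $S=R$ of arity $m$: if $\|x_k\|,\|y_k\|<N$ and $\|x_k-y_k\|<\delta(S,N,\varepsilon)$ for $1\le k\le m$, then $\|f^E(\vec x)-f^E(\vec y)\|\le\varepsilon$, respectively $|R^E(\vec x)-R^E(\vec y)|\le\varepsilon$; and if $\|x_k\|\le N$ for $1\le k\le m$, then $\|f^E(\vec x)\|\le K(f,N)$, respectively $|R^E(\vec x)|\le K(R,N)$. **The logic $L_{PB}$.** Terms are built from countably many variables, $0$, $+$, multiplication by rational scalars and the function symbols. The formulas of $L_{PB}$ are built from the atomic formulas $\|t\|\le r$, $\|t\|\ge r$, $R(\vec t)\le r$, $R(\vec t)\ge r$ ($r\in\mathbb Q$) by binary $\wedge$ and $\vee$,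 countable conjunctions $\bigwedge_{i=1}^\infty$ and the bounded quantifiers $\exists y(\|y\|\le r\wedge\varphi)$ and $\forall y(\|y\|\le r\Rightarrow\varphi)$ with $r\in\mathbb Q$. A conjunction or disjunction of finitely many (at least one) formulas is the iterated binary one. For an integer $n\ge1$ the approximation $\varphi_n$ is defined by $$(\|t\|\le r)_n:\ \|t\|\le r+\tfrac1n,\qquad(\|t\|\ge r)_n:\ \|t\|\ge r-\tfrac1n,$$ likewise for $R(\vec t)$; $(\varphi\wedge\psi)_n:\varphi_n\wedge\psi_n$; $(\varphi\vee\psi)_n:\varphi_n\vee\psi_n$; $(\bigwedge_{i=1}^\infty\varphi_i)_n:\bigwedge_{i=1}^n(\varphi_i)_n$; $(\exists y(\|y\|\le r\wedge\varphi))_n:\exists y(\|y\|\le r+\frac1n\wedge\varphi_n)$; $(\forall y(\|y\|\le r\Rightarrow\varphi))_n:\forall y(\|y\|\le r-\frac1n\Rightarrow\varphi_n)$. The formula $neg(\varphi,n)$ is defined by $$neg(\|t\|\le r,n):\ \|t\|\ge r+\tfrac1n,\qquad neg(\|t\|\ge r,n):\ \|t\|\le r-\tfrac1n,$$ likewise for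 $R(\vec t)$; $neg(\varphi\wedge\psi,n):neg(\varphi,n)\vee neg(\psi,n)$; $neg(\varphi\vee\psi,n):neg(\varphi,n)\wedge neg(\psi,n)$; $neg(\bigwedge_{i=1}^\infty\varphi_i,n):\bigvee_{i=1}^n neg(\varphi_i,n)$; $neg(\exists y(\|y\|\le r\wedge\varphi),n):\forall y(\|y\|\le r+\frac1n\Rightarrow neg(\varphi,n))$; $neg(\forall y(\|y\|\le r\Rightarrow\varphi),n):\exists y(\|y\|\le r-\frac1n\wedge neg(\varphi,n))$. **The logic $L_A$.** Its formulas are built, by conjunctions of finitely many (at least one) formulas, countable conjunctions $\bigwedge_{i=1}^\infty$, negation, and quantification $\exists\vec y(\bigwedge_{i=1}^\infty\|y_i\|\le r_i\wedge\varphi)$ over a sequence $\vec y=(y_1,y_2,\dots)$ of distinct variables with rational $r_i\ge0$, from those formulas of $L_{PB}$ in which the bound $r$ of every existential quantifier is $\ge0$ and that of every universal quantifier is $>0$. Satisfaction $\models$ is defined in the natural way. A sentence is a formula without free variables. **Trees of approximations.** For $\varphi\in L_A$ the set $I(\varphi)$ of branches and the formulas $[\varphi]_h\in L_{PB}$, $h\in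 I(\varphi)$, are defined by recursion: * for $\varphi\in L_{PB}$: $I(\varphi)=\{\emptyset\}$ and $[\varphi]_\emptyset:\varphi$; * for finite or countable conjunctions: $I(\bigwedge_i\varphi_i)=\prod_iI(\varphi_i)$ and $[\bigwedge_i\varphi_i]_h:\bigwedge_i[\varphi_i]_{h(i)}$; * $I(\neg\varphi)$ is the set of all sequences $f=(f_1(s),f_2(s))_{s\ge1}$ in $I(\varphi)\times\{1,2,\dots\}$ such that for every $h\in I(\varphi)$ there is $s$ for which $([\varphi]_h)_{f_2(s)}$ and $([\varphi]_{f_1(s)})_{f_2(s)}$ are identical formulas; and $[\neg\varphi]_f:\bigwedge_{s=1}^\infty neg([\varphi]_{f_1(s)},f_2(s))$; * $I(\exists\vec y(\bigwedge_{i=1}^\infty\|y_i\|\le r_i\wedge\varphi))=I(\varphi)$, and $[\exists\vec y(\bigwedge_{i=1}^\infty\|y_i\|\le r_i\wedge\varphi)]_h$ is $\bigwedge_{n=1}^\infty\exists y_1(\|y_1\|\le r_1\wedge\dots\exists y_{k}(\|y_{k}\|\le r_{k}\wedge([\varphi]_h)_n)\dots)$, where $k=k(n)$ is the largest index such that $y_k$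 is free in $([\varphi]_h)_n$ ($k=0$ if there is none). **Theorem (Uniformity Theorem for $L_A$).** Let $\Omega$ be a countable signature, $\Sigma$ a set of sentences of $L_{PB}$ and $\neg\varphi$ a sentence of $L_A$. If every normed space structure that satisfies $\Sigma$ satisfies $\neg\varphi$, then for every $h\in I(\varphi)$ there is an integer $n\ge1$ such that no normed space structure that satisfies $\Sigma$ satisfies $([\varphi]_h)_n$, that is, $\Sigma\models\neg([\varphi]_h)_n$. -/

import Mathlib

/-!
Normed space structures, positive bounded formulas, the infinitary logic `L_A`, and the tree of
approximations of a formula of `L_A`.  The variables are `x₀, x₁, x₂, …`, named by `ℕ`.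
Families indexed by `1, 2, 3, …` on paper are indexed by `ℕ` here (shifted by one); the
approximation parameter `n` is a positive integer, of type `ℕ+`.
-/

universe u v w

/-- A signature for normed space structures: function symbols (constants are the symbols of
arity `0`) and symbols for real-valued relations, with moduli of uniform continuity and bounds. -/
structure NSSignature where
  Fun : Type u
  Rel : Type v
  funArity : Fun → ℕ
  relArity : Rel → ℕ
  /-- `funModulus f N ε` is the `δ(f, N, ε)` -/
  funModulus : Fun → ℕ → ℚ → ℚ
  relModulus : Rel → ℕ → ℚ → ℚ
  funModulus_pos : ∀ f N ε, 0 < N → 0 < ε → 0 < funModulus f N ε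
  relModulus_pos : ∀ R N ε, 0 < N → 0 < ε → 0 < relModulus R N ε
  /-- `funBound f N` is the `K(f, N)` -/
  funBound : Fun → ℤ → ℤ
  relBound : Rel → ℤ → ℤ

/-- A normed space structure of signature `Ω`: a real normed space with an interpretation of the
symbols that obeys the moduli of uniform continuity and the bounds of `Ω`. -/
structure NSStructure (Ω : NSSignature.{u, v}) where
  carrier : Type w
  [normedGroup : NormedAddCommGroup carrier]
  [normedSpace : NormedSpace ℝ carrier]
  funMap : ∀ f : Ω.Fun, (Fin (Ω.funArity f) → carrier) → carrier
  relMap : ∀ R : Ω.Rel, (Fin (Ω.relArity R) → carrier) → ℝ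
  fun_modulus : ∀ (f : Ω.Fun) (N : ℕ) (ε : ℚ), 0 < N → 0 < ε →
    ∀ x y : Fin (Ω.funArity f) → carrier,
      (∀ k, ‖x k‖ < N ∧ ‖y k‖ < N ∧ ‖x k - y k‖ < Ω.funModulus f N ε) →
      ‖funMap f x - funMap f y‖ ≤ ε
  rel_modulus : ∀ (R : Ω.Rel) (N : ℕ) (ε : ℚ), 0 < N → 0 < ε →
    ∀ x y : Fin (Ω.relArity R) → carrier,
      (∀ k, ‖x k‖ < N ∧ ‖y k‖ < N ∧ ‖x k - y k‖ < Ω.relModulus R N ε) →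
      |relMap R x - relMap R y| ≤ ε
  fun_bound : ∀ (f : Ω.Fun) (N : ℤ) (x : Fin (Ω.funArity f) → carrier),
    (∀ k, ‖x k‖ ≤ N) → ‖funMap f x‖ ≤ Ω.funBound f N
  rel_bound : ∀ (R : Ω.Rel) (N : ℤ) (x : Fin (Ω.relArity R) → carrier),
    (∀ k, ‖x k‖ ≤ N) → |relMap R x| ≤ Ω.relBound R N

attribute [instance] NSStructure.normedGroup NSStructure.normedSpace

/-- Terms of the first order language of `Ω`. -/
inductive NSTerm (Ω : NSSignature.{u, v}) : Type u
  | var (x : ℕ) : NSTerm Ω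
  | zero : NSTerm Ω
  | add (s t : NSTerm Ω) : NSTerm Ω
  | smul (q : ℚ) (t : NSTerm Ω) : NSTerm Ω
  | func (f : Ω.Fun) (t : Fin (Ω.funArity f) → NSTerm Ω) : NSTerm Ω

/-- Positive bounded formulas.  The norm bounds of the quantifiers are arbitrary rational numbers
here, because approximations shift them; the sign conditions are in `PBFormula.Admissible`. -/
inductive PBFormula (Ω : NSSignature.{u, v}) : Type (max u v)
  /-- `‖t‖ ≤ r` -/
  | normLe (t : NSTerm Ω) (r : ℚ) : PBFormula Ω
  /-- `‖t‖ ≥ r` -/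
  | normGe (t : NSTerm Ω) (r : ℚ) : PBFormula Ω
  /-- `R(t₁, …, tₘ) ≤ r` -/
  | relLe (R : Ω.Rel) (t : Fin (Ω.relArity R) → NSTerm Ω) (r : ℚ) : PBFormula Ω
  /-- `R(t₁, …, tₘ) ≥ r` -/
  | relGe (R : Ω.Rel) (t : Fin (Ω.relArity R) → NSTerm Ω) (r : ℚ) : PBFormula Ω
  | and (φ ψ : PBFormula Ω) : PBFormula Ω
  | or (φ ψ : PBFormula Ω) : PBFormula Ω
  /-- countable conjunction -/
  | iAnd (φ : ℕ → PBFormula Ω) : PBFormula Ω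
  /-- `∃ y (‖y‖ ≤ r ∧ φ)` -/
  | ex (y : ℕ) (r : ℚ) (φ : PBFormula Ω) : PBFormula Ω
  /-- `∀ y (‖y‖ ≤ r ⇒ φ)` -/
  | all (y : ℕ) (r : ℚ) (φ : PBFormula Ω) : PBFormula Ω

section Formulas

variable {Ω : NSSignature.{u, v}}

/-- The variables of a term. -/
def NSTerm.vars : NSTerm Ω → Set ℕ
  | .var x => {x}
  | .zero => ∅
  | .add s t => s.vars ∪ t.vars
  | .smul _ t => t.vars
  | .func _ t => ⋃ i, (t i).vars

namespace PBFormula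

/-- The free variables of a positive bounded formula. -/
def freeVars : PBFormula Ω → Set ℕ
  | normLe t _ => t.vars
  | normGe t _ => t.vars
  | relLe _ t _ => ⋃ i, (t i).vars
  | relGe _ t _ => ⋃ i, (t i).vars
  | and φ ψ => φ.freeVars ∪ ψ.freeVars
  | or φ ψ => φ.freeVars ∪ ψ.freeVars
  | iAnd φ => ⋃ i, (φ i).freeVars
  | ex y _ φ => φ.freeVars \ {y}
  | all y _ φ => φ.freeVars \ {y}

/-- The norm bounds of existential quantifiers are nonnegative and those of universal
quantifiers are positive. -/
def Admissible : PBFormula Ω → Prop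
  | normLe _ _ => True
  | normGe _ _ => True
  | relLe _ _ _ => True
  | relGe _ _ _ => True
  | and φ ψ => φ.Admissible ∧ ψ.Admissible
  | or φ ψ => φ.Admissible ∧ ψ.Admissible
  | iAnd φ => ∀ i, (φ i).Admissible
  | ex _ r φ => 0 ≤ r ∧ φ.Admissible
  | all _ r φ => 0 < r ∧ φ.Admissible

/-- The finite conjunction of `m + 1` formulas, as an iterated binary conjunction. -/
def finAnd : (m : ℕ) → (Fin (m + 1) → PBFormula Ω) → PBFormula Ω
  | 0, φ => φ 0
  | m + 1, φ => and (finAnd m fun i => φ i.castSucc) (φ (Fin.last (m + 1)))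

/-- The finite disjunction of `m + 1` formulas, as an iterated binary disjunction. -/
def finOr : (m : ℕ) → (Fin (m + 1) → PBFormula Ω) → PBFormula Ω
  | 0, φ => φ 0
  | m + 1, φ => or (finOr m fun i => φ i.castSucc) (φ (Fin.last (m + 1)))

/-- The `n`-th approximation `φₙ`.  A countable conjunction is replaced by the conjunction of the
approximations of its first `n` members (`n.natPred + 1 = n`). -/
def approx : PBFormula Ω → ℕ+ → PBFormula Ω
  | normLe t r, n => normLe t (r + 1 / (n : ℚ))
  | normGe t r, n => normGe t (r - 1 / (n : ℚ))
  | relLe R t r, n => relLe R t (r + 1 / (n : ℚ))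
  | relGe R t r, n => relGe R t (r - 1 / (n : ℚ))
  | and φ ψ, n => and (φ.approx n) (ψ.approx n)
  | or φ ψ, n => or (φ.approx n) (ψ.approx n)
  | iAnd φ, n => finAnd n.natPred fun i => (φ i).approx n
  | ex y r φ, n => ex y (r + 1 / (n : ℚ)) (φ.approx n)
  | all y r φ, n => all y (r - 1 / (n : ℚ)) (φ.approx n)

/-- The weak approximate negation `neg(φ, n)`. -/
def neg : PBFormula Ω → ℕ+ → PBFormula Ω
  | normLe t r, n => normGe t (r + 1 / (n : ℚ))
  | normGe t r, n => normLe t (r - 1 / (n : ℚ))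
  | relLe R t r, n => relGe R t (r + 1 / (n : ℚ))
  | relGe R t r, n => relLe R t (r - 1 / (n : ℚ))
  | and φ ψ, n => or (φ.neg n) (ψ.neg n)
  | or φ ψ, n => and (φ.neg n) (ψ.neg n)
  | iAnd φ, n => finOr n.natPred fun i => (φ i).neg n
  | ex y r φ, n => all y (r + 1 / (n : ℚ)) (φ.neg n)
  | all y r φ, n => ex y (r - 1 / (n : ℚ)) (φ.neg n)

/-- `∃ y₀ (‖y₀‖ ≤ r₀ ∧ ∃ y₁ (‖y₁‖ ≤ r₁ ∧ … ∃ yₖ₋₁ (‖yₖ₋₁‖ ≤ rₖ₋₁ ∧ φ) … ))`, where `yᵢ` is the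
variable `y i`. -/
def exBlock (y : ℕ → ℕ) (r : ℕ → ℚ) : ℕ → PBFormula Ω → PBFormula Ω
  | 0, φ => φ
  | k + 1, φ => exBlock y r k (ex (y k) (r k) φ)

/-- The least `k` such that the variables of the sequence `y` that are free in `φ` are among
`y 0, …, y (k - 1)`, for a formula with finitely many free variables; so it is `0` if none of them
is free in `φ`, and otherwise one more than the largest `i` with `y i` free in `φ`. -/
noncomputable def ind (y : ℕ → ℕ) (φ : PBFormula Ω) : ℕ :=
  sSup {k | ∃ i, y i ∈ φ.freeVars ∧ k = i + 1}

end PBFormula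

/-- The formulas of `L_A`. -/
inductive LAFormula (Ω : NSSignature.{u, v}) : Type (max u v)
  | ofPB (φ : PBFormula Ω) (hφ : φ.Admissible) : LAFormula Ω
  /-- the conjunction of finitely many, but at least one, formulas -/
  | finAnd (m : ℕ) (φ : Fin (m + 1) → LAFormula Ω) : LAFormula Ω
  /-- countable conjunction -/
  | iAnd (φ : ℕ → LAFormula Ω) : LAFormula Ω
  | not (φ : LAFormula Ω) : LAFormula Ω
  /-- `∃ (y₀, y₁, …) (⋀ ‖yᵢ‖ ≤ rᵢ ∧ φ)`, where `yᵢ` is the variable `y i` -/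
  | ex (y : ℕ ↪ ℕ) (r : ℕ → ℚ≥0) (φ : LAFormula Ω) : LAFormula Ω

/-- A set `I` of branches together with a positive bounded formula for every branch. -/
structure ApproxTree (Ω : NSSignature.{u, v}) where
  I : Type
  form : I → PBFormula Ω

namespace LAFormula

/-- The free variables of a formula of `L_A`. -/
def freeVars : LAFormula Ω → Set ℕ
  | ofPB φ _ => φ.freeVars
  | finAnd _ φ => ⋃ i, (φ i).freeVars
  | iAnd φ => ⋃ i, (φ i).freeVars
  | not φ => φ.freeVars
  | ex y _ φ => φ.freeVars \ Set.range y

/-- The set `I(φ)` and the formulas `[φ]_h`, `h ∈ I(φ)`, by recursion on `φ`. -/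
noncomputable def tree : LAFormula Ω → ApproxTree Ω
  | ofPB φ _ => ⟨Unit, fun _ => φ⟩
  | finAnd m φ =>
      ⟨∀ i, (φ i).tree.I, fun h => PBFormula.finAnd m fun i => (φ i).tree.form (h i)⟩
  | iAnd φ =>
      ⟨∀ i, (φ i).tree.I, fun h => PBFormula.iAnd fun i => (φ i).tree.form (h i)⟩
  | not φ =>
      ⟨{f : ℕ → φ.tree.I × ℕ+ // ∀ h : φ.tree.I, ∃ s : ℕ,
          (φ.tree.form h).approx (f s).2 = (φ.tree.form (f s).1).approx (f s).2},
        fun f => PBFormula.iAnd fun s => (φ.tree.form (f.1 s).1).neg (f.1 s).2⟩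
  | ex y r φ =>
      ⟨φ.tree.I, fun h => PBFormula.iAnd fun n =>
        PBFormula.exBlock y (fun i => (r i : ℚ))
          (((φ.tree.form h).approx n.succPNat).ind y) ((φ.tree.form h).approx n.succPNat)⟩

/-- The set `I(φ)` of branches of the tree of approximations of `φ`. -/
def Branch (φ : LAFormula Ω) : Type := φ.tree.I

/-- The positive bounded formula `[φ]_h`. -/
noncomputable def atBranch (φ : LAFormula Ω) (h : φ.Branch) : PBFormula Ω := φ.tree.form h

end LAFormula

/-! Approximations have only finitely many free variables, so `ind` is used only where the set of
natural numbers in its definition is bounded. -/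

theorem NSTerm.finite_vars (t : NSTerm Ω) : t.vars.Finite := by
  induction t with
  | var x => exact Set.finite_singleton x
  | zero => exact Set.finite_empty
  | add s t hs ht => exact hs.union ht
  | smul q t ht => exact ht
  | func f t ht => exact Set.finite_iUnion ht

theorem PBFormula.finite_freeVars_finAnd (m : ℕ) (φ : Fin (m + 1) → PBFormula Ω)
    (hφ : ∀ i, (φ i).freeVars.Finite) : (PBFormula.finAnd m φ).freeVars.Finite := by
  induction m with
  | zero => exact hφ 0
  | succ m ih => exact (ih _ fun i => hφ i.castSucc).union (hφ _)

theorem PBFormula.finite_freeVars_approx (φ : PBFormula Ω) (n : ℕ+) :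
    (φ.approx n).freeVars.Finite := by
  induction φ with
  | normLe t r => exact t.finite_vars
  | normGe t r => exact t.finite_vars
  | relLe R t r => exact Set.finite_iUnion fun i => (t i).finite_vars
  | relGe R t r => exact Set.finite_iUnion fun i => (t i).finite_vars
  | and φ ψ h₁ h₂ => exact h₁.union h₂
  | or φ ψ h₁ h₂ => exact h₁.union h₂
  | iAnd φ h => exact PBFormula.finite_freeVars_finAnd _ _ fun i => h i
  | ex y r φ h => exact h.subset Set.sdiff_subset
  | all y r φ h => exact h.subset Set.sdiff_subset

theorem PBFormula.lt_ind_approx (y : ℕ ↪ ℕ) (φ : PBFormula Ω) (n : ℕ+) (i : ℕ)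
    (hi : y i ∈ (φ.approx n).freeVars) : i < (φ.approx n).ind y := by
  have hfin : {k | ∃ i, y i ∈ (φ.approx n).freeVars ∧ k = i + 1}.Finite := by
    refine (((φ.finite_freeVars_approx n).preimage y.injective.injOn).image (· + 1)).subset ?_
    rintro k ⟨j, hj, rfl⟩
    exact ⟨j, hj, rfl⟩
  exact Nat.lt_of_succ_le (le_csSup hfin.bddAbove ⟨i, hi, rfl⟩)

end Formulas

section Satisfaction

variable {Ω : NSSignature.{u, v}}

/-- The value of a term under an assignment `a` of elements of `E` to the variables. -/
def NSTerm.eval (E : NSStructure.{u, v, w} Ω) (a : ℕ → E.carrier) : NSTerm Ω → E.carrier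
  | .var x => a x
  | .zero => 0
  | .add s t => s.eval E a + t.eval E a
  | .smul q t => (q : ℝ) • t.eval E a
  | .func f t => E.funMap f fun i => (t i).eval E a

/-- Satisfaction of a positive bounded formula under an assignment. -/
def PBFormula.Sat (E : NSStructure.{u, v, w} Ω) : PBFormula Ω → (ℕ → E.carrier) → Prop
  | .normLe t r, a => ‖t.eval E a‖ ≤ (r : ℝ)
  | .normGe t r, a => (r : ℝ) ≤ ‖t.eval E a‖
  | .relLe R t r, a => E.relMap R (fun i => (t i).eval E a) ≤ (r : ℝ)
  | .relGe R t r, a => (r : ℝ) ≤ E.relMap R (fun i => (t i).eval E a)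
  | .and φ ψ, a => φ.Sat E a ∧ ψ.Sat E a
  | .or φ ψ, a => φ.Sat E a ∨ ψ.Sat E a
  | .iAnd φ, a => ∀ i, (φ i).Sat E a
  | .ex y r φ, a => ∃ b : E.carrier, ‖b‖ ≤ (r : ℝ) ∧ φ.Sat E (Function.update a y b)
  | .all y r φ, a => ∀ b : E.carrier, ‖b‖ ≤ (r : ℝ) → φ.Sat E (Function.update a y b)

/-- Satisfaction of a formula of `L_A` under an assignment.  The assignment
`Function.extend y b a` maps the variable `y i` to `b i` and agrees with `a` elsewhere. -/
def LAFormula.Sat (E : NSStructure.{u, v, w} Ω) : LAFormula Ω → (ℕ → E.carrier) → Prop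
  | .ofPB φ _, a => φ.Sat E a
  | .finAnd _ φ, a => ∀ i, (φ i).Sat E a
  | .iAnd φ, a => ∀ i, (φ i).Sat E a
  | .not φ, a => ¬ φ.Sat E a
  | .ex y r φ, a => ∃ b : ℕ → E.carrier,
      (∀ i, ‖b i‖ ≤ ((r i : ℚ) : ℝ)) ∧ φ.Sat E (Function.extend y b a)

/-- `E ⊨ Γ` for a set `Γ` of positive bounded sentences. -/
def NSStructure.IsModel (E : NSStructure.{u, v, w} Ω) (Γ : Set (PBFormula Ω)) : Prop :=
  ∀ σ ∈ Γ, ∀ a : ℕ → E.carrier, σ.Sat E a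

end Satisfaction

/-!
Suppose that for every `n` some structure `Eₙ` satisfies `Γ` together with the `n`-th approximation
of `[φ]_h`.  The ultraproduct `E` of the `Eₙ` (bounded sequences modulo sequences whose norms tend
to `0` along a nonprincipal ultrafilter) is again a structure of the same signature, and it
satisfies `Γ`, because exact truth in almost all factors passes to it.  It remains to see that `E`
satisfies `φ`, which contradicts the hypothesis on `φ`.

The link is approximate truth, `PBFormula.ApproxSat`: a positive bounded formula `χ` is
approximately true if every approximation `χₘ` holds in almost all factors.  For formulas that obey
the sign conditions this is truth in `E` (`PBFormula.sat_ultraproduct_iff`).  The formulas `[φ]_h`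
need not obey the sign conditions, since approximate negations shift the bounds of the quantifiers,
so for them approximate truth is used throughout in place of truth in `E`.
`LAFormula.sat_ultraproduct_iff_exists_branch` says that `E` satisfies a formula `φ` of `L_A` if and
only if `[φ]_h` is approximately true for some branch `h`; the proof is an induction on `φ`.

* Negation.  If no `[φ]_h` is approximately true, then for each `h` some `neg([φ]_h, m)` is
  approximately true, because `neg(χ, m)` holds wherever `χₘ` fails.  There are only countably many
  approximations, so countably many of these pairs `(h, m)` form a branch of `¬φ`.  Conversely,
  `neg(χ, m)` is determined by `χₘ` (`PBFormula.dual_approx`), and approximations of `χ` and of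
  `neg(χ, m)` are eventually contradictory (`PBFormula.not_sat_approx_neg`).
* Quantification over infinitely many variables.  Witnesses for the finite quantifier blocks of the
  successive approximations are combined by a diagonal choice (`Ultrafilter.exists_diagonal`).
-/

open Filter Topology

/-! ### Ultraproducts of normed spaces -/

section NormedUltraproduct

variable {ι : Type*} (U : Ultrafilter ι) (X : ι → Type w) [∀ j, NormedAddCommGroup (X j)]
  [∀ j, NormedSpace ℝ (X j)]

/-- The space of the norm-bounded families in `∀ j, X j`. -/
def boundedFamilies : Submodule ℝ (∀ j, X j) where
  carrier := {x | ∃ C : ℝ, ∀ j, ‖x j‖ ≤ C}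
  add_mem' := by
    rintro x y ⟨C, hC⟩ ⟨D, hD⟩
    exact ⟨C + D, fun j => (norm_add_le _ _).trans (add_le_add (hC j) (hD j))⟩
  zero_mem' := ⟨0, fun j => by simp⟩
  smul_mem' := by
    rintro c x ⟨C, hC⟩
    exact ⟨‖c‖ * C, fun j => (norm_smul_le _ _).trans
      (mul_le_mul_of_nonneg_left (hC j) (norm_nonneg c))⟩

/-- The bounded families, as a type of its own: it carries the seminorm `lim_U ‖x j‖`, and not the
product topology.  The ultrafilter is a parameter of the type since the seminorm depends on it. -/
def BoundedFamily (_U : Ultrafilter ι) : Type _ := boundedFamilies X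

namespace BoundedFamily

variable {U X}

instance : AddCommGroup (BoundedFamily X U) := inferInstanceAs (AddCommGroup (boundedFamilies X))

instance : Module ℝ (BoundedFamily X U) := inferInstanceAs (Module ℝ (boundedFamilies X))

instance : CoeFun (BoundedFamily X U) fun _ => ∀ j, X j := ⟨fun x => x.1⟩

/-- The bounded family with given members. -/
def of (x : ∀ j, X j) (hx : ∃ C : ℝ, ∀ j, ‖x j‖ ≤ C) : BoundedFamily X U := ⟨x, hx⟩

@[simp] theorem zero_apply (j : ι) : (0 : BoundedFamily X U) j = 0 := rfl
@[simp] theorem add_apply (x y : BoundedFamily X U) (j : ι) : (x + y) j = x j + y j := rfl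
@[simp] theorem sub_apply (x y : BoundedFamily X U) (j : ι) : (x - y) j = x j - y j := rfl
@[simp] theorem neg_apply (x : BoundedFamily X U) (j : ι) : (-x) j = -x j := rfl
@[simp] theorem smul_apply (c : ℝ) (x : BoundedFamily X U) (j : ι) : (c • x) j = c • x j := rfl

theorem bounded (x : BoundedFamily X U) : ∃ C : ℝ, ∀ j, ‖x j‖ ≤ C := x.2

end BoundedFamily

theorem Ultrafilter.tendsto_limUnder_of_abs_le {f : ι → ℝ} {C : ℝ} (hf : ∀ j, |f j| ≤ C) :
    Tendsto f U (𝓝 (limUnder (U : Filter ι) f)) := by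
  apply tendsto_nhds_limUnder
  have hmem : Set.Icc (-C) C ∈ (U.map f : Filter ℝ) :=
    Filter.mem_map.mpr (Filter.univ_mem' fun j => abs_le.mp (hf j))
  obtain ⟨L, -, hL⟩ := (isCompact_Icc (a := -C) (b := C)).ultrafilter_le_nhds (U.map f)
    (le_principal_iff.mpr hmem)
  exact ⟨L, hL⟩

variable {U X}

theorem BoundedFamily.tendsto_limUnder_norm (x : BoundedFamily X U) :
    Tendsto (fun j => ‖x j‖) U (𝓝 (limUnder (U : Filter ι) fun j => ‖x j‖)) := by
  obtain ⟨C, hC⟩ := x.bounded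
  exact Ultrafilter.tendsto_limUnder_of_abs_le U (C := C) fun j => by simpa using hC j

/-- The seminorm `lim_U ‖x j‖` on bounded families. -/
noncomputable def BoundedFamily.limNorm : AddGroupSeminorm (BoundedFamily X U) where
  toFun x := limUnder (U : Filter ι) fun j => ‖x j‖
  map_zero' := (tendsto_nhds_unique (BoundedFamily.tendsto_limUnder_norm (0 : BoundedFamily X U))
    (by simp))
  add_le' x y := le_of_tendsto_of_tendsto' (x + y).tendsto_limUnder_norm
    (x.tendsto_limUnder_norm.add y.tendsto_limUnder_norm) fun j => norm_add_le _ _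
  neg' x := by simp

noncomputable instance : SeminormedAddCommGroup (BoundedFamily X U) :=
  BoundedFamily.limNorm.toSeminormedAddCommGroup

theorem BoundedFamily.tendsto_norm (x : BoundedFamily X U) :
    Tendsto (fun j => ‖x j‖) U (𝓝 ‖x‖) := x.tendsto_limUnder_norm

noncomputable instance : NormedSpace ℝ (BoundedFamily X U) where
  norm_smul_le c x := le_of_tendsto_of_tendsto' (c • x).tendsto_norm
    (x.tendsto_norm.const_mul ‖c‖) fun j => norm_smul_le c (x j)

variable (U X)

/-- The ultraproduct of normed spaces: bounded families modulo those whose norms tend to `0` along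
the ultrafilter. -/
noncomputable abbrev NormedUltraproduct : Type _ := SeparationQuotient (BoundedFamily X U)

variable {U X}

namespace NormedUltraproduct

/-- The element of the ultraproduct represented by a bounded family. -/
noncomputable abbrev ofFamily (x : BoundedFamily X U) : NormedUltraproduct U X :=
  SeparationQuotient.mk x

theorem tendsto_norm (x : BoundedFamily X U) : Tendsto (fun j => ‖x j‖) U (𝓝 ‖ofFamily x‖) := by
  rw [SeparationQuotient.norm_mk]; exact x.tendsto_norm

theorem norm_ofFamily_le {x : BoundedFamily X U} {r : ℝ} (h : ∀ᶠ j in U, ‖x j‖ ≤ r) :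
    ‖ofFamily x‖ ≤ r :=
  le_of_tendsto (tendsto_norm x) h

theorem ofFamily_sub (x y : BoundedFamily X U) : ofFamily (x - y) = ofFamily x - ofFamily y := rfl

theorem ofFamily_eq_iff {x y : BoundedFamily X U} :
    ofFamily x = ofFamily y ↔ Tendsto (fun j => ‖x j - y j‖) U (𝓝 0) := by
  have h := tendsto_norm (x - y)
  rw [ofFamily_sub] at h
  constructor
  · intro hxy
    simpa [hxy] using h
  · intro h0
    exact sub_eq_zero.mp (norm_eq_zero.mp (tendsto_nhds_unique h h0))

/-- A vector of norm at most `r` can be represented by a family of vectors of norm at most `r`: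
radial truncation moves the members of a representing family by an infinitesimal amount. -/
theorem exists_rep_norm_le (e : NormedUltraproduct U X) {r : ℝ} (hr : ‖e‖ ≤ r) :
    ∃ x : BoundedFamily X U, ofFamily x = e ∧ ∀ j, ‖x j‖ ≤ r := by
  obtain ⟨y, rfl⟩ := SeparationQuotient.surjective_mk e
  have hr0 : 0 ≤ r := (norm_nonneg _).trans hr
  have key : ∀ j, ∃ z : X j, ‖z‖ ≤ r ∧ ‖z - y j‖ ≤ max (‖y j‖ - r) 0 := by
    intro j
    rcases le_or_gt ‖y j‖ r with h | h
    · exact ⟨y j, h, by simp⟩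
    · have hpos : 0 < ‖y j‖ := hr0.trans_lt h
      refine ⟨(r / ‖y j‖) • y j, ?_, ?_⟩
      · rw [norm_smul, Real.norm_of_nonneg (by positivity), div_mul_cancel₀ _ hpos.ne']
      · have : (r / ‖y j‖) • y j - y j = (r / ‖y j‖ - 1) • y j := by rw [sub_smul, one_smul]
        rw [this, norm_smul, Real.norm_eq_abs, abs_sub_comm,
          abs_of_nonneg (sub_nonneg.mpr ((div_le_one hpos).mpr h.le)), sub_mul, one_mul,
          div_mul_cancel₀ _ hpos.ne']
        exact le_max_left _ _
  choose z hz hzy using key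
  refine ⟨.of z ⟨r, hz⟩, ofFamily_eq_iff.mpr ?_, hz⟩
  have hlim : Tendsto (fun j => max (‖y j‖ - r) 0) U (𝓝 (max (‖ofFamily y‖ - r) 0)) :=
    ((tendsto_norm y).sub_const r).max tendsto_const_nhds
  rw [max_eq_right (by linarith)] at hlim
  exact squeeze_zero (fun j => norm_nonneg _) hzy hlim

/-- A family of maps with a common modulus of uniform continuity respects that modulus along the
ultrafilter. -/
theorem eventually_norm_sub_le {m : ℕ} {Y : ι → Type*} [∀ j, SeminormedAddCommGroup (Y j)]
    (g : ∀ j, (Fin m → X j) → Y j) {N δ ε : ℝ}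
    (hg : ∀ j, ∀ x y : Fin m → X j, (∀ k, ‖x k‖ < N ∧ ‖y k‖ < N ∧ ‖x k - y k‖ < δ) →
      ‖g j x - g j y‖ ≤ ε)
    (x y : Fin m → BoundedFamily X U)
    (h : ∀ k, ‖ofFamily (x k)‖ < N ∧ ‖ofFamily (y k)‖ < N ∧ ‖ofFamily (x k) - ofFamily (y k)‖ < δ) :
    ∀ᶠ j in U, ‖g j (fun k => x k j) - g j (fun k => y k j)‖ ≤ ε := by
  have h' : ∀ᶠ j in (U : Filter ι), ∀ k, ‖x k j‖ < N ∧ ‖y k j‖ < N ∧ ‖x k j - y k j‖ < δ := by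
    refine eventually_all.mpr fun k => ?_
    have hk := (h k).2.2
    rw [← ofFamily_sub] at hk
    exact ((tendsto_norm (x k)).eventually_lt_const (h k).1).and
      (((tendsto_norm (y k)).eventually_lt_const (h k).2.1).and
        ((tendsto_norm (x k - y k)).eventually_lt_const hk))
  exact h'.mono fun j hj => hg j _ _ hj

/-- A family of maps with common moduli of uniform continuity maps representatives of equal vectors
to families that are infinitely close. -/
theorem tendsto_norm_sub_zero {m : ℕ} {Y : ι → Type*} [∀ j, SeminormedAddCommGroup (Y j)]
    (g : ∀ j, (Fin m → X j) → Y j) {δ : ℕ → ℚ → ℚ} (hδ : ∀ N ε, 0 < N → 0 < ε → 0 < δ N ε)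
    (hg : ∀ j, ∀ (N : ℕ) (ε : ℚ), 0 < N → 0 < ε → ∀ x y : Fin m → X j,
      (∀ k, ‖x k‖ < N ∧ ‖y k‖ < N ∧ ‖x k - y k‖ < δ N ε) → ‖g j x - g j y‖ ≤ ε)
    (x y : Fin m → BoundedFamily X U) (h : ∀ k, ofFamily (x k) = ofFamily (y k)) :
    Tendsto (fun j => ‖g j (fun k => x k j) - g j (fun k => y k j)‖) U (𝓝 0) := by
  obtain ⟨N, hN⟩ := exists_nat_gt (∑ k, ‖ofFamily (x k)‖)
  have hN0 : 0 < N := by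
    exact_mod_cast (Finset.sum_nonneg fun k _ => norm_nonneg (ofFamily (x k))).trans_lt hN
  have hlt : ∀ k, ‖ofFamily (x k)‖ < N := fun k =>
    (Finset.single_le_sum (f := fun k => ‖ofFamily (x k)‖) (fun k _ => norm_nonneg _)
      (Finset.mem_univ k)).trans_lt hN
  rw [Metric.tendsto_nhds]
  intro η hη
  obtain ⟨ε, hε0, hε⟩ := exists_rat_btwn hη
  have hε0' : 0 < ε := by exact_mod_cast hε0
  refine (eventually_norm_sub_le g (fun j => hg j N ε hN0 hε0') x y fun k =>
    ⟨hlt k, h k ▸ hlt k, ?_⟩).mono fun j hj => ?_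
  · simpa [h k] using hδ N ε hN0 hε0'
  · simpa using hj.trans_lt hε

theorem exists_forall_norm_le {m : ℕ} (x : Fin m → BoundedFamily X U) :
    ∃ N : ℤ, ∀ k j, ‖x k j‖ ≤ N := by
  choose C hC using fun k => (x k).bounded
  obtain ⟨N, hN⟩ := exists_nat_ge (∑ k, |C k|)
  refine ⟨N, fun k j => (hC k j).trans ((le_abs_self _).trans ?_)⟩
  exact (Finset.single_le_sum (f := fun k => |C k|) (fun k _ => abs_nonneg _)
    (Finset.mem_univ k)).trans (by exact_mod_cast hN)

/-- A chosen bounded family representing a vector of the ultraproduct. -/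
noncomputable def rep (e : NormedUltraproduct U X) : BoundedFamily X U :=
  (SeparationQuotient.surjective_mk e).choose

@[simp] theorem ofFamily_rep (e : NormedUltraproduct U X) : ofFamily (rep e) = e :=
  (SeparationQuotient.surjective_mk e).choose_spec

end NormedUltraproduct

end NormedUltraproduct

open NormedUltraproduct

/-! ### Ultraproducts of normed space structures -/

section StructureUltraproduct

variable {Ω : NSSignature.{u, v}} {ι : Type} (U : Ultrafilter ι) (F : ι → NSStructure.{u, v, w} Ω)

/-- The bounded families of elements of the structures `F j`. -/
abbrev NSStructure.Family : Type w := BoundedFamily (fun j => (F j).carrier) U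

variable {U F}

/-- The family of the values of a function symbol on families of arguments. -/
def NSStructure.Family.app (f : Ω.Fun) (x : Fin (Ω.funArity f) → NSStructure.Family U F) :
    NSStructure.Family U F :=
  .of (fun j => (F j).funMap f fun k => x k j) <| by
    obtain ⟨N, hN⟩ := exists_forall_norm_le x
    exact ⟨Ω.funBound f N, fun j => (F j).fun_bound f N _ fun k => hN k j⟩

theorem NSStructure.Family.ofFamily_app_congr (f : Ω.Fun)
    {x y : Fin (Ω.funArity f) → NSStructure.Family U F} (h : ∀ k, ofFamily (x k) = ofFamily (y k)) :
    ofFamily (app f x) = ofFamily (app f y) :=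
  ofFamily_eq_iff.mpr <| tendsto_norm_sub_zero (fun j => (F j).funMap f) (Ω.funModulus_pos f)
    (fun j => (F j).fun_modulus f) x y h

theorem NSStructure.Family.tendsto_relMap (R : Ω.Rel)
    (x : Fin (Ω.relArity R) → NSStructure.Family U F) :
    Tendsto (fun j => (F j).relMap R fun k => x k j) U
      (𝓝 (limUnder (U : Filter ι) fun j => (F j).relMap R fun k => x k j)) := by
  obtain ⟨N, hN⟩ := exists_forall_norm_le x
  exact Ultrafilter.tendsto_limUnder_of_abs_le U fun j => (F j).rel_bound R N _ fun k => hN k j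

theorem NSStructure.Family.limUnder_relMap_congr (R : Ω.Rel)
    {x y : Fin (Ω.relArity R) → NSStructure.Family U F} (h : ∀ k, ofFamily (x k) = ofFamily (y k)) :
    (limUnder (U : Filter ι) fun j => (F j).relMap R fun k => x k j) =
      limUnder (U : Filter ι) fun j => (F j).relMap R fun k => y k j := by
  have h0 := tendsto_norm_sub_zero (fun j => (F j).relMap R) (Ω.relModulus_pos R)
    (fun j => (F j).rel_modulus R) x y h
  exact sub_eq_zero.mp (tendsto_nhds_unique ((tendsto_relMap R x).sub (tendsto_relMap R y))
    (tendsto_zero_iff_norm_tendsto_zero.mpr h0))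

variable (U F)

/-- The ultraproduct of normed space structures. -/
noncomputable def NSStructure.ultraproduct : NSStructure.{u, v, w} Ω where
  carrier := NormedUltraproduct U fun j => (F j).carrier
  funMap f x := ofFamily (Family.app f fun k => rep (x k))
  relMap R x := limUnder (U : Filter ι) fun j => (F j).relMap R fun k => rep (x k) j
  fun_modulus f N ε hN hε x y h := by
    rw [← ofFamily_sub]
    exact norm_ofFamily_le (eventually_norm_sub_le (fun j => (F j).funMap f)
      (fun j => (F j).fun_modulus f N ε hN hε) (fun k => rep (x k)) (fun k => rep (y k))
      (by simpa using h))
  rel_modulus R N ε hN hε x y h :=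
    le_of_tendsto (((Family.tendsto_relMap R fun k => rep (x k)).sub
        (Family.tendsto_relMap R fun k => rep (y k))).abs)
      (eventually_norm_sub_le (fun j => (F j).relMap R)
        (fun j => (F j).rel_modulus R N ε hN hε) (fun k => rep (x k)) (fun k => rep (y k))
        (by simpa using h))
  fun_bound f N x h := by
    -- the bound holds only at representatives whose members all obey the bound on the arguments
    choose y hy hyN using fun k => exists_rep_norm_le (x k) (h k)
    rw [Family.ofFamily_app_congr f (y := y) fun k => by rw [ofFamily_rep, hy]]
    exact norm_ofFamily_le (.of_forall fun j => (F j).fun_bound f N _ fun k => hyN k j)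
  rel_bound R N x h := by
    choose y hy hyN using fun k => exists_rep_norm_le (x k) (h k)
    rw [Family.limUnder_relMap_congr R (y := y) fun k => by rw [ofFamily_rep, hy]]
    exact le_of_tendsto (Family.tendsto_relMap R y).abs
      (.of_forall fun j => (F j).rel_bound R N _ fun k => hyN k j)

variable {U F}

/-- The assignment in `F j` given by the `j`-th members of an assignment of bounded families. -/
def NSStructure.Family.coord (a : ℕ → NSStructure.Family U F) (j : ι) : ℕ → (F j).carrier :=
  fun v => a v j

/-- The assignment in the ultraproduct represented by an assignment of bounded families. -/
noncomputable def NSStructure.Family.cls (a : ℕ → NSStructure.Family U F) :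
    ℕ → (NSStructure.ultraproduct U F).carrier :=
  fun v => ofFamily (a v)

/-- The value of a term in the ultraproduct is represented by its values in the factors. -/
theorem NSTerm.exists_eval_eq (t : NSTerm Ω) (a : ℕ → NSStructure.Family U F) :
    ∃ x : NSStructure.Family U F, (∀ j, x j = t.eval (F j) (NSStructure.Family.coord a j)) ∧
      t.eval (NSStructure.ultraproduct U F) (NSStructure.Family.cls a) = ofFamily x := by
  induction t with
  | var x => exact ⟨a x, fun j => rfl, rfl⟩
  | zero => exact ⟨0, fun j => rfl, rfl⟩
  | add s t hs ht =>
    obtain ⟨x, hx, hx'⟩ := hs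
    obtain ⟨y, hy, hy'⟩ := ht
    exact ⟨x + y, fun j => by simp [NSTerm.eval, hx, hy], by
      simp only [NSTerm.eval, hx', hy']; rfl⟩
  | smul q t ht =>
    obtain ⟨x, hx, hx'⟩ := ht
    exact ⟨(q : ℝ) • x, fun j => by simp [NSTerm.eval, hx], by
      simp only [NSTerm.eval, hx']; rfl⟩
  | func f t ht =>
    choose x hx hx' using ht
    refine ⟨.app f x, fun j => congrArg ((F j).funMap f) (funext fun k => hx k j), ?_⟩
    simp only [NSTerm.eval, hx']
    exact NSStructure.Family.ofFamily_app_congr f fun k => ofFamily_rep _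

theorem NSTerm.tendsto_norm_eval (t : NSTerm Ω) (a : ℕ → NSStructure.Family U F) :
    Tendsto (fun j => ‖t.eval (F j) (NSStructure.Family.coord a j)‖) U
      (𝓝 ‖t.eval (NSStructure.ultraproduct U F) (NSStructure.Family.cls a)‖) := by
  obtain ⟨x, hx, hx'⟩ := t.exists_eval_eq a
  simp only [← hx, hx']
  exact tendsto_norm x

theorem NSStructure.tendsto_relMap_eval (R : Ω.Rel) (t : Fin (Ω.relArity R) → NSTerm Ω)
    (a : ℕ → NSStructure.Family U F) :
    Tendsto (fun j => (F j).relMap R fun k => (t k).eval (F j) (NSStructure.Family.coord a j)) U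
      (𝓝 ((NSStructure.ultraproduct U F).relMap R fun k =>
        (t k).eval (NSStructure.ultraproduct U F) (NSStructure.Family.cls a))) := by
  choose x hx hx' using fun k => (t k).exists_eval_eq a
  simp only [← hx, hx']
  have h : (NSStructure.ultraproduct U F).relMap R (fun k => ofFamily (x k)) = _ :=
    Family.limUnder_relMap_congr R fun k => ofFamily_rep _
  rw [h]
  exact Family.tendsto_relMap R x

end StructureUltraproduct

/-! ### Approximations and approximate negations -/

section Approximation

variable {Ω : NSSignature.{u, v}}

namespace PBFormula

theorem sat_finAnd (E : NSStructure.{u, v, w} Ω) (a : ℕ → E.carrier) (m : ℕ)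
    (φ : Fin (m + 1) → PBFormula Ω) : (finAnd m φ).Sat E a ↔ ∀ i, (φ i).Sat E a := by
  induction m with
  | zero => exact ⟨fun h i => by rwa [Fin.fin_one_eq_zero i], fun h => h 0⟩
  | succ m ih =>
    rw [finAnd, PBFormula.Sat, ih]
    exact (Fin.forall_fin_succ' (P := fun i => (φ i).Sat E a)).symm

theorem sat_finOr (E : NSStructure.{u, v, w} Ω) (a : ℕ → E.carrier) (m : ℕ)
    (φ : Fin (m + 1) → PBFormula Ω) : (finOr m φ).Sat E a ↔ ∃ i, (φ i).Sat E a := by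
  induction m with
  | zero => exact ⟨fun h => ⟨0, h⟩, fun ⟨i, h⟩ => by rwa [Fin.fin_one_eq_zero i] at h⟩
  | succ m ih =>
    rw [finOr, PBFormula.Sat, ih]
    exact (Fin.exists_fin_succ' (P := fun i => (φ i).Sat E a)).symm

theorem approx_finAnd (m : ℕ) (φ : Fin (m + 1) → PBFormula Ω) (n : ℕ+) :
    (finAnd m φ).approx n = finAnd m fun i => (φ i).approx n := by
  induction m with
  | zero => rfl
  | succ m ih => simp [finAnd, approx, ih]

theorem approx_finOr (m : ℕ) (φ : Fin (m + 1) → PBFormula Ω) (n : ℕ+) :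
    (finOr m φ).approx n = finOr m fun i => (φ i).approx n := by
  induction m with
  | zero => rfl
  | succ m ih => simp [finOr, approx, ih]

theorem sat_finAnd_natPred (E : NSStructure.{u, v, w} Ω) (a : ℕ → E.carrier) (n : ℕ+)
    (φ : ℕ → PBFormula Ω) :
    (finAnd n.natPred fun i => φ i).Sat E a ↔ ∀ i < (n : ℕ), (φ i).Sat E a := by
  rw [sat_finAnd, Fin.forall_iff]
  simp only [PNat.natPred_add_one]

theorem sat_finOr_natPred (E : NSStructure.{u, v, w} Ω) (a : ℕ → E.carrier) (n : ℕ+)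
    (φ : ℕ → PBFormula Ω) :
    (finOr n.natPred fun i => φ i).Sat E a ↔ ∃ i < (n : ℕ), (φ i).Sat E a := by
  rw [sat_finOr, Fin.exists_iff]
  simp only [PNat.natPred_add_one, exists_prop]

theorem sat_approx_of_sat (E : NSStructure.{u, v, w} Ω) (n : ℕ+) (φ : PBFormula Ω)
    (a : ℕ → E.carrier) (h : φ.Sat E a) : (φ.approx n).Sat E a := by
  have hn : (0 : ℚ) < 1 / (n : ℚ) := by positivity
  induction φ generalizing a with
  | normLe t r => exact h.trans (Rat.cast_le.mpr (by linarith))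
  | normGe t r => exact (Rat.cast_le.mpr (by linarith)).trans h
  | relLe R t r => exact h.trans (Rat.cast_le.mpr (by linarith))
  | relGe R t r => exact (Rat.cast_le.mpr (by linarith)).trans h
  | and φ ψ h₁ h₂ => exact ⟨h₁ a h.1, h₂ a h.2⟩
  | or φ ψ h₁ h₂ => exact h.imp (h₁ a) (h₂ a)
  | iAnd φ ih => exact (sat_finAnd E a _ _).mpr fun i => ih _ a (h i)
  | ex y r φ ih =>
    obtain ⟨b, hb, hφ⟩ := h
    exact ⟨b, hb.trans (Rat.cast_le.mpr (by linarith)), ih _ hφ⟩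
  | all y r φ ih => exact fun b hb => ih _ (h b (hb.trans (Rat.cast_le.mpr (by linarith))))

/-- Iterated approximations are controlled by a single one. -/
theorem sat_approx_of_sat_approx_approx (E : NSStructure.{u, v, w} Ω) {k m n : ℕ+}
    (hk : 1 / (n : ℚ) + 1 / (m : ℚ) ≤ 1 / (k : ℚ)) (φ : PBFormula Ω) (a : ℕ → E.carrier)
    (h : ((φ.approx n).approx m).Sat E a) : (φ.approx k).Sat E a := by
  induction φ generalizing a with
  | normLe t r => exact h.trans (Rat.cast_le.mpr (by linarith))
  | normGe t r => exact (Rat.cast_le.mpr (by linarith)).trans h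
  | relLe R t r => exact h.trans (Rat.cast_le.mpr (by linarith))
  | relGe R t r => exact (Rat.cast_le.mpr (by linarith)).trans h
  | and φ ψ h₁ h₂ => exact ⟨h₁ a h.1, h₂ a h.2⟩
  | or φ ψ h₁ h₂ => exact h.imp (h₁ a) (h₂ a)
  | iAnd φ ih =>
    have hkn : (k : ℕ) ≤ n := by
      have hm : (0 : ℚ) < 1 / (m : ℚ) := by positivity
      have : 1 / (n : ℚ) ≤ 1 / (k : ℚ) := by linarith
      exact_mod_cast (one_div_le_one_div (by positivity) (by positivity)).mp this
    rw [approx, approx_finAnd, sat_finAnd_natPred E a n fun i => ((φ i).approx n).approx m] at h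
    rw [approx, sat_finAnd_natPred E a k fun i => (φ i).approx k]
    exact fun i hi => ih i a (h i (hi.trans_le hkn))
  | ex y r φ ih =>
    obtain ⟨b, hb, hφ⟩ := h
    exact ⟨b, hb.trans (Rat.cast_le.mpr (by linarith)), ih _ hφ⟩
  | all y r φ ih => exact fun b hb => ih _ (h b (hb.trans (Rat.cast_le.mpr (by linarith))))

theorem sat_approx_mono (E : NSStructure.{u, v, w} Ω) {k n : ℕ+} (hkn : k ≤ n) (φ : PBFormula Ω)
    (a : ℕ → E.carrier) (h : (φ.approx n).Sat E a) : (φ.approx k).Sat E a := by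
  rcases hkn.eq_or_lt with rfl | hlt
  · exact h
  · refine sat_approx_of_sat_approx_approx E (m := k * n) ?_ φ a (sat_approx_of_sat E _ _ a h)
    have hlt' : (k : ℚ) + 1 ≤ n := by exact_mod_cast hlt
    have hk0 : (0 : ℚ) < k := by positivity
    have hn0 : (0 : ℚ) < n := by positivity
    push_cast
    rw [div_add_div _ _ hn0.ne' (by positivity), div_le_div_iff₀ (by positivity) hk0]
    nlinarith [mul_le_mul_of_nonneg_left hlt' (mul_pos hk0 hn0).le]

theorem sat_neg_of_not_sat_approx (E : NSStructure.{u, v, w} Ω) (n : ℕ+) (φ : PBFormula Ω)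
    (a : ℕ → E.carrier) (h : ¬ (φ.approx n).Sat E a) : (φ.neg n).Sat E a := by
  induction φ generalizing a with
  | normLe t r => exact (not_le.mp h).le
  | normGe t r => exact (not_le.mp h).le
  | relLe R t r => exact (not_le.mp h).le
  | relGe R t r => exact (not_le.mp h).le
  | and φ ψ h₁ h₂ => exact (not_and_or.mp h).imp (h₁ a) (h₂ a)
  | or φ ψ h₁ h₂ => exact ⟨h₁ a fun h' => h (.inl h'), h₂ a fun h' => h (.inr h')⟩
  | iAnd φ ih =>
    rw [approx, sat_finAnd] at h
    obtain ⟨i, hi⟩ := not_forall.mp h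
    exact (sat_finOr E a _ _).mpr ⟨i, ih _ a hi⟩
  | ex y r φ ih => exact fun b hb => ih _ fun h' => h ⟨b, hb, h'⟩
  | all y r φ ih =>
    by_contra hneg
    exact h fun b hb => by_contra fun h' => hneg ⟨b, hb, ih _ h'⟩

/-- A formula and an approximate negation of it have contradictory approximations. -/
theorem not_sat_approx_neg (E : NSStructure.{u, v, w} Ω) {m k : ℕ+} (hk : 2 * m < k)
    (φ : PBFormula Ω) (a : ℕ → E.carrier) (h : (φ.approx k).Sat E a) :
    ¬ ((φ.neg m).approx k).Sat E a := by
  have hlt : 1 / (k : ℚ) + 1 / (k : ℚ) < 1 / (m : ℚ) := by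
    have hk' : 2 * (m : ℚ) < k := by exact_mod_cast hk
    have hm0 : (0 : ℚ) < m := by positivity
    have hk0 : (0 : ℚ) < k := by positivity
    rw [← add_div, div_lt_div_iff₀ hk0 hm0]
    linarith
  induction φ generalizing a with
  | normLe t r =>
    exact fun h' => (h.trans_lt (Rat.cast_lt.mpr (by linarith))).not_ge h'
  | normGe t r =>
    exact fun h' => (h'.trans_lt (Rat.cast_lt.mpr (by linarith))).not_ge h
  | relLe R t r =>
    exact fun h' => (h.trans_lt (Rat.cast_lt.mpr (by linarith))).not_ge h'
  | relGe R t r =>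
    exact fun h' => (h'.trans_lt (Rat.cast_lt.mpr (by linarith))).not_ge h
  | and φ ψ h₁ h₂ => exact fun h' => h'.elim (h₁ a h.1) (h₂ a h.2)
  | or φ ψ h₁ h₂ => exact fun h' => h.elim (fun h => h₁ a h h'.1) fun h => h₂ a h h'.2
  | iAnd φ ih =>
    rw [approx, sat_finAnd_natPred E a k fun i => (φ i).approx k] at h
    rw [neg, approx_finOr, sat_finOr_natPred E a m fun i => ((φ i).neg m).approx k]
    rintro ⟨i, hi, h'⟩
    have hm : (m : ℕ) ≤ k := by
      have : 2 * (m : ℕ) < k := by exact_mod_cast hk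
      omega
    exact ih i a (h i (hi.trans_le hm)) h'
  | ex y r φ ih =>
    obtain ⟨b, hb, hφ⟩ := h
    exact fun h' => ih _ hφ (h' b (hb.trans (Rat.cast_le.mpr (by linarith))))
  | all y r φ ih =>
    rintro ⟨b, hb, hφ⟩
    exact ih _ (h b (hb.trans (Rat.cast_le.mpr (by linarith)))) hφ

/-- Exchange `∧` with `∨`, `∃` with `∀`, and `≤` with `≥`, in a formula without infinite
conjunctions; the value at an infinite conjunction is irrelevant. -/
def dual : PBFormula Ω → PBFormula Ω
  | normLe t r => normGe t r
  | normGe t r => normLe t r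
  | relLe R t r => relGe R t r
  | relGe R t r => relLe R t r
  | and φ ψ => or φ.dual ψ.dual
  | or φ ψ => and φ.dual ψ.dual
  | iAnd φ => iAnd φ
  | ex y r φ => all y r φ.dual
  | all y r φ => ex y r φ.dual

theorem dual_finAnd (m : ℕ) (φ : Fin (m + 1) → PBFormula Ω) :
    (finAnd m φ).dual = finOr m fun i => (φ i).dual := by
  induction m with
  | zero => rfl
  | succ m ih => simp [finAnd, finOr, dual, ih]

/-- The approximate negation `neg(φ, n)` depends only on the approximation `φₙ`. -/
theorem dual_approx (φ : PBFormula Ω) (n : ℕ+) : (φ.approx n).dual = φ.neg n := by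
  induction φ <;> simp_all [approx, neg, dual, dual_finAnd]

/-! ### Free variables -/

theorem freeVars_finAnd (m : ℕ) (φ : Fin (m + 1) → PBFormula Ω) :
    (finAnd m φ).freeVars = ⋃ i, (φ i).freeVars := by
  induction m with
  | zero => exact (Set.iUnion_eq_const fun i => by rw [Fin.fin_one_eq_zero i]; rfl).symm
  | succ m ih =>
    ext x
    simp only [finAnd, freeVars, ih, Set.mem_union, Set.mem_iUnion]
    exact (Fin.exists_fin_succ' (P := fun i => x ∈ (φ i).freeVars)).symm

theorem freeVars_dual (φ : PBFormula Ω) : φ.dual.freeVars = φ.freeVars := by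
  induction φ <;> simp_all [dual, freeVars]

theorem freeVars_approx_subset (φ : PBFormula Ω) (n : ℕ+) :
    (φ.approx n).freeVars ⊆ φ.freeVars := by
  induction φ with
  | normLe | normGe | relLe | relGe => exact subset_rfl
  | and φ ψ h₁ h₂ => exact Set.union_subset_union h₁ h₂
  | or φ ψ h₁ h₂ => exact Set.union_subset_union h₁ h₂
  | iAnd φ ih =>
    rw [approx, freeVars_finAnd]
    exact Set.iUnion_subset fun i => (ih i).trans (Set.subset_iUnion (fun i => (φ i).freeVars) _)
  | ex y r φ ih => exact Set.sdiff_subset_sdiff_left ih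
  | all y r φ ih => exact Set.sdiff_subset_sdiff_left ih

theorem freeVars_neg_subset (φ : PBFormula Ω) (n : ℕ+) : (φ.neg n).freeVars ⊆ φ.freeVars := by
  rw [← dual_approx, freeVars_dual]
  exact φ.freeVars_approx_subset n

theorem _root_.NSTerm.eval_congr (E : NSStructure.{u, v, w} Ω) {a b : ℕ → E.carrier}
    (t : NSTerm Ω) (h : ∀ x ∈ t.vars, a x = b x) : t.eval E a = t.eval E b := by
  induction t with
  | var x => exact h x rfl
  | zero => rfl
  | add s t hs ht =>
    exact congrArg₂ (· + ·) (hs fun x hx => h x (.inl hx)) (ht fun x hx => h x (.inr hx))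
  | smul q t ht => exact congrArg _ (ht h)
  | func f t ht =>
    exact congrArg _ (funext fun i => ht i fun x hx => h x (Set.mem_iUnion.mpr ⟨i, hx⟩))

theorem sat_congr (E : NSStructure.{u, v, w} Ω) {a b : ℕ → E.carrier} (φ : PBFormula Ω)
    (h : ∀ x ∈ φ.freeVars, a x = b x) : φ.Sat E a ↔ φ.Sat E b := by
  have hupd : ∀ (s : Set ℕ) (y : ℕ) (c : E.carrier) (a b : ℕ → E.carrier),
      (∀ x ∈ s \ {y}, a x = b x) → ∀ x ∈ s, Function.update a y c x = Function.update b y c x := by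
    intro s y c a b hab x hx
    by_cases hxy : x = y
    · simp [hxy]
    · simp [hxy, hab x ⟨hx, hxy⟩]
  induction φ generalizing a b with
  | normLe t r | normGe t r => simp only [Sat, t.eval_congr E h]
  | relLe R t r | relGe R t r =>
    have ht : ∀ i, (t i).eval E a = (t i).eval E b := fun i =>
      (t i).eval_congr E fun x hx => h x (Set.mem_iUnion.mpr ⟨i, hx⟩)
    simp only [Sat, ht]
  | and φ ψ h₁ h₂ =>
    exact and_congr (h₁ fun x hx => h x (.inl hx)) (h₂ fun x hx => h x (.inr hx))
  | or φ ψ h₁ h₂ =>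
    exact or_congr (h₁ fun x hx => h x (.inl hx)) (h₂ fun x hx => h x (.inr hx))
  | iAnd φ ih => exact forall_congr' fun i => ih i fun x hx => h x (Set.mem_iUnion.mpr ⟨i, hx⟩)
  | ex y r φ ih => exact exists_congr fun c => and_congr_right' (ih (hupd _ y c a b h))
  | all y r φ ih => exact forall₂_congr fun c _ => ih (hupd _ y c a b h)

/-! ### Blocks of existential quantifiers -/

theorem approx_exBlock (y : ℕ → ℕ) (r : ℕ → ℚ) (k : ℕ) (φ : PBFormula Ω) (n : ℕ+) :
    (exBlock y r k φ).approx n = exBlock y (fun i => r i + 1 / (n : ℚ)) k (φ.approx n) := by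
  induction k generalizing φ with
  | zero => rfl
  | succ k ih => rw [exBlock, exBlock, ih]; rfl

theorem mem_freeVars_exBlock {y : ℕ → ℕ} {r : ℕ → ℚ} {k : ℕ} {φ : PBFormula Ω} {x : ℕ}
    (h : x ∈ (exBlock y r k φ).freeVars) : x ∈ φ.freeVars ∧ ∀ i < k, x ≠ y i := by
  induction k generalizing φ with
  | zero => exact ⟨h, by simp⟩
  | succ k ih =>
    obtain ⟨⟨hx, hxk⟩, hlt⟩ := ih h
    refine ⟨hx, fun i hi => ?_⟩
    rcases (Nat.lt_succ_iff_lt_or_eq.mp hi) with h' | rfl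
    · exact hlt i h'
    · exact hxk

theorem sat_exBlock (E : NSStructure.{u, v, w} Ω) (y : ℕ ↪ ℕ) (r : ℕ → ℚ) (k : ℕ)
    (φ : PBFormula Ω) (a : ℕ → E.carrier) :
    (exBlock y r k φ).Sat E a ↔ ∃ c : ℕ → E.carrier, (∀ x, (∀ i < k, x ≠ y i) → c x = a x) ∧
      (∀ i < k, ‖c (y i)‖ ≤ (r i : ℝ)) ∧ φ.Sat E c := by
  induction k generalizing φ with
  | zero =>
    refine ⟨fun h => ⟨a, fun _ _ => rfl, by simp, h⟩, ?_⟩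
    rintro ⟨c, hc, -, h⟩
    rwa [show c = a from funext fun x => hc x (by simp)] at h
  | succ k ih =>
    rw [exBlock, ih]
    constructor
    · rintro ⟨c, hca, hcr, b, hb, h⟩
      refine ⟨Function.update c (y k) b, fun x hx => ?_, fun i hi => ?_, h⟩
      · rw [Function.update_of_ne (hx k k.lt_succ_self)]
        exact hca x fun i hi => hx i (hi.trans k.lt_succ_self)
      · rcases (Nat.lt_succ_iff_lt_or_eq.mp hi) with h' | rfl
        · rw [Function.update_of_ne (y.injective.ne h'.ne)]
          exact hcr i h'
        · rwa [Function.update_self]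
    · rintro ⟨c, hca, hcr, h⟩
      refine ⟨Function.update c (y k) (a (y k)), fun x hx => ?_, fun i hi => ?_,
        c (y k), hcr k k.lt_succ_self, ?_⟩
      · by_cases hxk : x = y k
        · rw [hxk, Function.update_self]
        · rw [Function.update_of_ne hxk]
          refine hca x fun i hi => ?_
          rcases (Nat.lt_succ_iff_lt_or_eq.mp hi) with h' | rfl
          · exact hx i h'
          · exact hxk
      · rw [Function.update_of_ne (y.injective.ne hi.ne)]
        exact hcr i (hi.trans k.lt_succ_self)
      · rwa [Function.update_idem, Function.update_eq_self]

end PBFormula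

/-! ### Countability of the set of approximations -/

/-- A numerical code of a term, from a numbering of the function symbols. -/
def NSTerm.code (e : Ω.Fun → ℕ) : NSTerm Ω → ℕ
  | .var x => Nat.pair 0 x
  | .zero => Nat.pair 1 0
  | .add s t => Nat.pair 2 (Nat.pair (s.code e) (t.code e))
  | .smul q t => Nat.pair 3 (Nat.pair (Encodable.encode q) (t.code e))
  | .func f t => Nat.pair 4 (Nat.pair (e f) (Encodable.encode (List.ofFn fun i => (t i).code e)))

theorem NSTerm.code_injective {e : Ω.Fun → ℕ} (he : Function.Injective e) :
    Function.Injective (NSTerm.code (Ω := Ω) e) := by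
  intro s
  induction s with
  | var x => intro t h; cases t <;> simp_all [code]
  | zero => intro t h; cases t <;> simp_all [code]
  | add s s' h₁ h₂ =>
    intro t h
    cases t <;> simp only [code, Nat.pair_eq_pair] at h <;> try omega
    rw [h₁ h.2.1, h₂ h.2.2]
  | smul q s h₁ =>
    intro t h
    cases t <;> simp only [code, Nat.pair_eq_pair] at h <;> try omega
    rw [Encodable.encode_injective h.2.1, h₁ h.2.2]
  | func f s h₁ =>
    intro t h
    cases t <;> simp only [code, Nat.pair_eq_pair] at h <;> try omega
    obtain ⟨-, hf, hs⟩ := h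
    obtain rfl := he hf
    have := List.ofFn_injective (Encodable.encode_injective hs)
    exact congrArg _ (funext fun i => h₁ i (congrFun this i))

instance [Countable Ω.Fun] : Countable (NSTerm Ω) :=
  have ⟨_, he⟩ := Countable.exists_injective_nat Ω.Fun
  (NSTerm.code_injective he).countable

namespace PBFormula

/-- The formula contains no infinite conjunction. -/
def IsFinitary : PBFormula Ω → Prop
  | normLe _ _ => True
  | normGe _ _ => True
  | relLe _ _ _ => True
  | relGe _ _ _ => True
  | and φ ψ => φ.IsFinitary ∧ ψ.IsFinitary
  | or φ ψ => φ.IsFinitary ∧ ψ.IsFinitary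
  | iAnd _ => False
  | ex _ _ φ => φ.IsFinitary
  | all _ _ φ => φ.IsFinitary

theorem isFinitary_finAnd (m : ℕ) (φ : Fin (m + 1) → PBFormula Ω) (h : ∀ i, (φ i).IsFinitary) :
    (finAnd m φ).IsFinitary := by
  induction m with
  | zero => exact h 0
  | succ m ih => exact ⟨ih _ fun i => h _, h _⟩

theorem isFinitary_approx (φ : PBFormula Ω) (n : ℕ+) : (φ.approx n).IsFinitary := by
  induction φ with
  | iAnd φ ih => exact isFinitary_finAnd _ _ fun i => ih i
  | _ => simp_all [approx, IsFinitary]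

/-- A numerical code of a formula, from numberings of the arguments of its atomic subformulas; it
does not look into infinite conjunctions. -/
def code (e : NSTerm Ω × ℚ → ℕ) (d : (Σ R : Ω.Rel, Fin (Ω.relArity R) → NSTerm Ω) × ℚ → ℕ) :
    PBFormula Ω → ℕ
  | normLe t r => Nat.pair 0 (e (t, r))
  | normGe t r => Nat.pair 1 (e (t, r))
  | relLe R t r => Nat.pair 2 (d (⟨R, t⟩, r))
  | relGe R t r => Nat.pair 3 (d (⟨R, t⟩, r))
  | and φ ψ => Nat.pair 4 (Nat.pair (φ.code e d) (ψ.code e d))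
  | or φ ψ => Nat.pair 5 (Nat.pair (φ.code e d) (ψ.code e d))
  | iAnd _ => Nat.pair 6 0
  | ex y r φ => Nat.pair 7 (Nat.pair (Nat.pair y (Encodable.encode r)) (φ.code e d))
  | all y r φ => Nat.pair 8 (Nat.pair (Nat.pair y (Encodable.encode r)) (φ.code e d))

theorem code_injOn {e : NSTerm Ω × ℚ → ℕ}
    {d : (Σ R : Ω.Rel, Fin (Ω.relArity R) → NSTerm Ω) × ℚ → ℕ} (he : Function.Injective e)
    (hd : Function.Injective d) : Set.InjOn (code e d) {φ | φ.IsFinitary} := by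
  intro φ
  induction φ with
  | iAnd φ => intro h; exact h.elim
  | normLe t r | normGe t r =>
    intro _ ψ _ h
    cases ψ <;> simp only [code, Nat.pair_eq_pair] at h <;> try omega
    have := he h.2
    simp_all
  | relLe R t r | relGe R t r =>
    intro _ ψ _ h
    cases ψ <;> simp only [code, Nat.pair_eq_pair] at h <;> try omega
    cases hd h.2
    rfl
  | and φ φ' h₁ h₂ | or φ φ' h₁ h₂ =>
    intro hφ ψ hψ h
    cases ψ <;> simp only [code, Nat.pair_eq_pair] at h <;> try omega
    rw [h₁ hφ.1 hψ.1 h.2.1, h₂ hφ.2 hψ.2 h.2.2]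
  | ex y r φ h₁ | all y r φ h₁ =>
    intro (hφ : φ.IsFinitary) ψ hψ h
    cases ψ <;> simp only [code, Nat.pair_eq_pair] at h <;> try omega
    rw [h₁ hφ (show IsFinitary _ from hψ :) h.2.2, h.2.1.1, Encodable.encode_injective h.2.1.2]

theorem countable_isFinitary [Countable Ω.Fun] [Countable Ω.Rel] :
    {φ : PBFormula Ω | φ.IsFinitary}.Countable := by
  obtain ⟨e, he⟩ := Countable.exists_injective_nat (NSTerm Ω × ℚ)
  obtain ⟨d, hd⟩ :=
    Countable.exists_injective_nat ((Σ R : Ω.Rel, Fin (Ω.relArity R) → NSTerm Ω) × ℚ)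
  exact (Set.mapsTo_univ _ _).countable_of_injOn (code_injOn he hd) Set.countable_univ

end PBFormula

end Approximation

/-! ### Approximate truth and truth in an ultraproduct -/

section Los

variable {Ω : NSSignature.{u, v}}

/-- Diagonalization along an ultrafilter on `ℕ` that contains the cofinite sets. -/
theorem Ultrafilter.exists_diagonal {U : Ultrafilter ℕ} (hU : (U : Filter ℕ) ≤ atTop)
    {X : ℕ → Type*} [∀ j, Nonempty (X j)] (Q : ℕ → ∀ j, X j → Prop)
    (h : ∀ m, ∀ᶠ j in (U : Filter ℕ), ∃ b, Q m j b) :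
    ∃ b : ∀ j, X j, ∀ M, ∀ᶠ j in (U : Filter ℕ), ∃ m ≥ M, Q m j (b j) := by
  -- at `j`, a witness for the largest possible `m ≤ j`
  have key : ∀ j, ∃ b : X j, ∀ M ≤ j, (∃ b', Q M j b') → ∃ m ≥ M, Q m j b := by
    classical
    intro j
    by_cases hj : ∃ m ≤ j, ∃ b', Q m j b'
    · obtain ⟨m, hmj, hm⟩ := hj
      obtain ⟨b, hb⟩ := Nat.findGreatest_spec (P := fun m => ∃ b', Q m j b') hmj hm
      exact ⟨b, fun M hM hQ => ⟨_, Nat.le_findGreatest hM hQ, hb⟩⟩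
    · exact ⟨Classical.arbitrary _, fun M hM hQ => (hj ⟨M, hM, hQ⟩).elim⟩
  choose b hb using key
  refine ⟨b, fun M => ?_⟩
  filter_upwards [h M, hU (eventually_ge_atTop M)] with j hj hMj using hb j M hMj hj

theorem Rat.cast_add_one_div_le_of_le (r : ℚ) {m n : ℕ+} (h : m ≤ n) :
    ((r + 1 / (n : ℚ) : ℚ) : ℝ) ≤ ((r + 1 / (m : ℚ) : ℚ) : ℝ) := by
  have h' : (m : ℚ) ≤ n := by exact_mod_cast h
  exact Rat.cast_le.mpr (by gcongr)

theorem Rat.cast_add_one_div_le_add_one (r : ℚ) (m : ℕ+) :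
    ((r + 1 / (m : ℚ) : ℚ) : ℝ) ≤ (r : ℝ) + 1 := by
  simpa using Rat.cast_add_one_div_le_of_le r (one_le (a := m))

theorem PNat.exists_one_div_lt {ε : ℝ} (hε : 0 < ε) : ∃ m : ℕ+, 1 / (m : ℝ) < ε := by
  obtain ⟨n, hn⟩ := exists_nat_one_div_lt hε
  exact ⟨n.succPNat, by simpa using hn⟩

theorem Filter.Tendsto.le_rat_iff {ι : Type*} {l : Filter ι} [l.NeBot] {f : ι → ℝ} {L : ℝ}
    (hf : Tendsto f l (𝓝 L)) (r : ℚ) :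
    L ≤ r ↔ ∀ m : ℕ+, ∀ᶠ j in l, f j ≤ ((r + 1 / (m : ℚ) : ℚ) : ℝ) := by
  constructor
  · intro h m
    refine (hf.eventually_lt_const (h.trans_lt (Rat.cast_lt.mpr ?_))).mono fun j hj => hj.le
    have : (0 : ℚ) < 1 / (m : ℚ) := by positivity
    linarith
  · intro h
    refine le_of_forall_pos_le_add fun ε hε => ?_
    obtain ⟨m, hm⟩ := PNat.exists_one_div_lt hε
    refine (le_of_tendsto hf (h m)).trans ?_
    push_cast
    linarith

theorem Filter.Tendsto.rat_le_iff {ι : Type*} {l : Filter ι} [l.NeBot] {f : ι → ℝ} {L : ℝ}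
    (hf : Tendsto f l (𝓝 L)) (r : ℚ) :
    r ≤ L ↔ ∀ m : ℕ+, ∀ᶠ j in l, ((r - 1 / (m : ℚ) : ℚ) : ℝ) ≤ f j := by
  have h := hf.neg.le_rat_iff (-r)
  rw [Rat.cast_neg, neg_le_neg_iff] at h
  rw [h]
  refine forall_congr' fun m => eventually_congr (.of_forall fun j => ?_)
  rw [neg_le, ← Rat.cast_neg, neg_add, neg_neg, ← sub_eq_add_neg]

variable {U : Ultrafilter ℕ} {F : ℕ → NSStructure.{u, v, w} Ω}

namespace NSStructure.Family

theorem coord_update (a : ℕ → Family U F) (y : ℕ) (b : Family U F) (j : ℕ) :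
    coord (Function.update a y b) j = Function.update (coord a j) y (b j) :=
  funext fun x => Function.apply_update (fun _ z => z j) a y b x

theorem cls_update (a : ℕ → Family U F) (y : ℕ) (b : Family U F) :
    cls (Function.update a y b) = Function.update (cls a) y (ofFamily b) :=
  funext fun x => Function.apply_update (fun _ => ofFamily) a y b x

end NSStructure.Family

open NSStructure.Family

namespace PBFormula

/-- Approximate truth: every approximation holds in almost all of the structures `F j`. -/
def ApproxSat (φ : PBFormula Ω) (a : ℕ → NSStructure.Family U F) : Prop :=
  ∀ m : ℕ+, ∀ᶠ j in (U : Filter ℕ), (φ.approx m).Sat (F j) (coord a j)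

theorem ApproxSat.of_forall_exists_ge {φ : PBFormula Ω} {a : ℕ → NSStructure.Family U F}
    (h : ∀ M : ℕ, ∀ᶠ j in (U : Filter ℕ), ∃ m ≥ M, (φ.approx m.succPNat).Sat (F j) (coord a j)) :
    φ.ApproxSat a := by
  intro k
  filter_upwards [h k] with j hj
  obtain ⟨m, hm, hj⟩ := hj
  exact sat_approx_mono _ (PNat.coe_le_coe _ _ |>.mp (by simpa using hm.le.trans m.le_succ)) _ _ hj

theorem approxSat_finAnd {n : ℕ} {φ : Fin (n + 1) → PBFormula Ω}
    {a : ℕ → NSStructure.Family U F} :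
    (finAnd n φ).ApproxSat a ↔ ∀ i, (φ i).ApproxSat a := by
  simp only [ApproxSat, approx_finAnd, sat_finAnd, eventually_all]
  exact forall_comm

theorem approxSat_iAnd {φ : ℕ → PBFormula Ω} {a : ℕ → NSStructure.Family U F} :
    (iAnd φ).ApproxSat a ↔ ∀ i, (φ i).ApproxSat a := by
  constructor
  · intro h i m
    filter_upwards [h (m + i.succPNat)] with j hj
    rw [approx, sat_finAnd_natPred (F j) _ _ fun k => (φ k).approx (m + i.succPNat)] at hj
    refine sat_approx_mono _ (PNat.lt_add_right m _).le _ _ (hj i ?_)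
    simp only [PNat.add_coe, Nat.succPNat_coe]
    omega
  · intro h m
    simp only [approx, sat_finAnd, eventually_all]
    exact fun i => h i m

theorem approxSat_of_eventually_sat {φ : PBFormula Ω} {a : ℕ → NSStructure.Family U F}
    (h : ∀ᶠ j in (U : Filter ℕ), φ.Sat (F j) (coord a j)) : φ.ApproxSat a :=
  fun m => h.mono fun _ hj => sat_approx_of_sat _ m φ _ hj

/-- Exact truth in almost all factors passes to the ultraproduct. -/
theorem sat_ultraproduct_of_eventually_sat (φ : PBFormula Ω) (a : ℕ → NSStructure.Family U F)
    (h : ∀ᶠ j in (U : Filter ℕ), φ.Sat (F j) (coord a j)) :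
    φ.Sat (NSStructure.ultraproduct U F) (cls a) := by
  induction φ generalizing a with
  | normLe t r => exact le_of_tendsto (t.tendsto_norm_eval a) h
  | normGe t r => exact ge_of_tendsto (t.tendsto_norm_eval a) h
  | relLe R t r => exact le_of_tendsto (NSStructure.tendsto_relMap_eval R t a) h
  | relGe R t r => exact ge_of_tendsto (NSStructure.tendsto_relMap_eval R t a) h
  | and φ ψ h₁ h₂ => exact ⟨h₁ a (h.mono fun _ hj => hj.1), h₂ a (h.mono fun _ hj => hj.2)⟩
  | or φ ψ h₁ h₂ => exact (Ultrafilter.eventually_or.mp h).imp (h₁ a) (h₂ a)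
  | iAnd φ ih => exact fun i => ih i a (h.mono fun j hj => hj i)
  | ex y r φ ih =>
    have hr : (0 : ℝ) ≤ r := by
      obtain ⟨j, b, hb, -⟩ := h.exists
      exact (norm_nonneg b).trans hb
    have h' : ∀ j, ∃ b : (F j).carrier, ‖b‖ ≤ (r : ℝ) ∧
        ((ex y r φ).Sat (F j) (coord a j) → φ.Sat (F j) (Function.update (coord a j) y b)) := by
      intro j
      by_cases hj : (ex y r φ).Sat (F j) (coord a j)
      · obtain ⟨b, hb, hφ⟩ := hj
        exact ⟨b, hb, fun _ => hφ⟩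
      · exact ⟨0, by simpa using hr, fun hj' => (hj hj').elim⟩
    choose b hb hφ using h'
    refine ⟨ofFamily (.of b ⟨r, hb⟩), norm_ofFamily_le (.of_forall hb), ?_⟩
    rw [← cls_update]
    refine ih _ (h.mono fun j hj => ?_)
    rw [coord_update]
    exact hφ j hj
  | all y r φ ih =>
    intro e he
    obtain ⟨b, rfl, hb⟩ := exists_rep_norm_le e he
    rw [← cls_update]
    refine ih _ (h.mono fun j hj => ?_)
    rw [coord_update]
    exact hj _ (hb j)

theorem tendsto_norm_sub_zero_of_forall_exists_ge {x y : NSStructure.Family U F} {r : ℝ}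
    (h : ∀ M : ℕ, ∀ᶠ j in (U : Filter ℕ), ∃ m ≥ M, ‖x j - y j‖ ≤ r * (1 / ((m : ℝ) + 1))) :
    Tendsto (fun j => ‖x j - y j‖) U (𝓝 0) := by
  have hr : 0 ≤ |r| := abs_nonneg r
  rw [Metric.tendsto_nhds]
  intro ε hε
  obtain ⟨M, hM⟩ := exists_nat_one_div_lt (div_pos hε (by positivity : 0 < |r| + 1))
  filter_upwards [h M] with j hj
  obtain ⟨m, hm, hj⟩ := hj
  have hmM : 1 / ((m : ℝ) + 1) ≤ 1 / ((M : ℝ) + 1) :=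
    one_div_le_one_div_of_le (by positivity) (by simpa using hm)
  have h1 : 0 < 1 / ((m : ℝ) + 1) := by positivity
  rw [lt_div_iff₀ (by positivity)] at hM
  rw [Real.dist_eq, sub_zero, abs_norm]
  nlinarith [le_abs_self r]

/-- A positive bounded formula that obeys the sign conditions is true in the ultraproduct if and
only if it is approximately true in the factors. -/
theorem sat_ultraproduct_iff (hU : (U : Filter ℕ) ≤ atTop) (φ : PBFormula Ω) (hφ : φ.Admissible)
    (a : ℕ → NSStructure.Family U F) :
    φ.Sat (NSStructure.ultraproduct U F) (cls a) ↔ φ.ApproxSat a := by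
  induction φ generalizing a with
  | normLe t r => exact (t.tendsto_norm_eval a).le_rat_iff r
  | normGe t r => exact (t.tendsto_norm_eval a).rat_le_iff r
  | relLe R t r => exact (NSStructure.tendsto_relMap_eval R t a).le_rat_iff r
  | relGe R t r => exact (NSStructure.tendsto_relMap_eval R t a).rat_le_iff r
  | and φ ψ h₁ h₂ =>
    refine (and_congr (h₁ hφ.1 a) (h₂ hφ.2 a)).trans ?_
    simp only [ApproxSat, approx, Sat, eventually_and]
    exact forall_and.symm
  | or φ ψ h₁ h₂ =>
    refine (or_congr (h₁ hφ.1 a) (h₂ hφ.2 a)).trans ?_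
    simp only [ApproxSat, approx, Sat, Ultrafilter.eventually_or]
    refine ⟨fun h m => h.imp (· m) (· m), fun h => ?_⟩
    by_contra! hne
    -- if `φ` fails at `m` and `ψ` at `n`, both fail at `max m n`, since approximations decrease
    obtain ⟨⟨m, hm⟩, n, hn⟩ := hne
    rcases h (max m n) with h | h
    · exact Ultrafilter.eventually_not.mp hm (h.mono fun j =>
        sat_approx_mono _ (le_max_left m n) _ _)
    · exact Ultrafilter.eventually_not.mp hn (h.mono fun j =>
        sat_approx_mono _ (le_max_right m n) _ _)
  | iAnd φ ih => exact (forall_congr' fun i => ih i (hφ i) a).trans approxSat_iAnd.symm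
  | ex y r φ ih =>
    constructor
    · rintro ⟨e, he, h⟩ m
      obtain ⟨b, rfl⟩ := SeparationQuotient.surjective_mk e
      rw [← cls_update, ih hφ.2] at h
      filter_upwards [h m, ((NormedUltraproduct.tendsto_norm b).le_rat_iff r).mp he m] with j hj hb
      rw [coord_update] at hj
      exact ⟨b j, hb, hj⟩
    · intro h
      have hr : (0 : ℝ) ≤ r := by exact_mod_cast hφ.1
      let X (j : ℕ) : Type w := {b : (F j).carrier // ‖b‖ ≤ (r : ℝ) + 1}
      have : ∀ j, Nonempty (X j) := fun j => ⟨0, by simp only [norm_zero]; positivity⟩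
      obtain ⟨b, hb⟩ := Ultrafilter.exists_diagonal hU (X := X)
        (fun m j b => ‖b.1‖ ≤ ((r + 1 / (m.succPNat : ℚ) : ℚ) : ℝ) ∧
          (φ.approx m.succPNat).Sat (F j) (Function.update (coord a j) y b.1)) fun m =>
        (h m.succPNat).mono fun j ⟨b, hb, hj⟩ => ⟨⟨b, hb.trans
          (Rat.cast_add_one_div_le_add_one r m.succPNat)⟩, hb, hj⟩
      refine ⟨ofFamily (.of (fun j => (b j).1) ⟨r + 1, fun j => (b j).2⟩), ?_, ?_⟩
      · refine ((NormedUltraproduct.tendsto_norm _).le_rat_iff r).mpr fun k => ?_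
        filter_upwards [hb k] with j hj
        obtain ⟨m, hm, hj, -⟩ := hj
        exact hj.trans (Rat.cast_add_one_div_le_of_le r
          (PNat.coe_le_coe _ _ |>.mp (by simpa using hm.le.trans m.le_succ)))
      · rw [← cls_update, ih hφ.2]
        refine .of_forall_exists_ge fun M => (hb M).mono fun j ⟨m, hm, _, hj⟩ => ⟨m, hm, ?_⟩
        rwa [coord_update]
  | all y r φ ih =>
    constructor
    · intro h
      by_contra hne
      obtain ⟨m, hm⟩ := not_forall.mp hne
      rw [← Ultrafilter.eventually_not] at hm
      have hm' : ∀ᶠ j in (U : Filter ℕ), ∃ b : (F j).carrier, ‖b‖ ≤ ((r - 1 / (m : ℚ) : ℚ) : ℝ) ∧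
          ¬ (φ.approx m).Sat (F j) (Function.update (coord a j) y b) := by
        refine hm.mono fun j hj => ?_
        simpa only [approx, Sat, not_forall, exists_prop] using hj
      have hr : ((r - 1 / (m : ℚ) : ℚ) : ℝ) ≤ r := by
        have : (0 : ℚ) < 1 / (m : ℚ) := by positivity
        exact Rat.cast_le.mpr (by linarith)
      have hr0 : (0 : ℝ) ≤ r := by
        obtain ⟨j, b, hb, -⟩ := hm'.exists
        exact (norm_nonneg b).trans (hb.trans hr)
      have h' : ∀ j, ∃ b : (F j).carrier, ‖b‖ ≤ (r : ℝ) ∧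
          ((∃ b : (F j).carrier, ‖b‖ ≤ ((r - 1 / (m : ℚ) : ℚ) : ℝ) ∧
            ¬ (φ.approx m).Sat (F j) (Function.update (coord a j) y b)) →
          ¬ (φ.approx m).Sat (F j) (Function.update (coord a j) y b)) := by
        intro j
        by_cases hj : ∃ b : (F j).carrier, ‖b‖ ≤ ((r - 1 / (m : ℚ) : ℚ) : ℝ) ∧
            ¬ (φ.approx m).Sat (F j) (Function.update (coord a j) y b)
        · obtain ⟨b, hb, hφ⟩ := hj
          exact ⟨b, hb.trans hr, fun _ => hφ⟩
        · exact ⟨0, by simpa using hr0, fun hj' => (hj hj').elim⟩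
      choose b hb hbφ using h'
      have hsat := h (ofFamily (.of b ⟨r, hb⟩)) (norm_ofFamily_le (.of_forall hb))
      rw [← cls_update, ih hφ.2] at hsat
      obtain ⟨j, hj, hj'⟩ := ((hsat m).and hm').exists
      rw [coord_update] at hj
      exact hbφ j hj' hj
    · intro h e he
      have hr : (0 : ℝ) < r := by exact_mod_cast hφ.1
      obtain ⟨b, rfl, hb⟩ := exists_rep_norm_le e he
      let X (j : ℕ) : Type w := {c : (F j).carrier // ‖c‖ ≤ (r : ℝ)}
      have : ∀ j, Nonempty (X j) := fun j => ⟨0, by simpa using hr.le⟩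
      -- a vector of norm at most `r` is infinitely close to one whose members `c j` satisfy
      -- `‖c j‖ ≤ r - 1 / k` for finite `k` tending to infinity along the ultrafilter
      obtain ⟨c, hc⟩ := Ultrafilter.exists_diagonal hU (X := X)
        (fun m j c => ‖c.1 - b j‖ ≤ r * (1 / ((m : ℝ) + 1)) ∧
          (φ.approx m.succPNat).Sat (F j) (Function.update (coord a j) y c.1)) <| by
        intro m
        have hs0 : 0 < 1 / ((m : ℝ) + 1) := by positivity
        have hs1 : 1 / ((m : ℝ) + 1) ≤ 1 := by
          rw [div_le_one (by positivity)]; simp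
        obtain ⟨k, hk⟩ := PNat.exists_one_div_lt (mul_pos hr hs0)
        filter_upwards [h (max k m.succPNat)] with j hj
        have hkm : 1 / (((max k m.succPNat : ℕ+) : ℚ) : ℝ) ≤ 1 / ((k : ℚ) : ℝ) := by
          refine one_div_le_one_div_of_le (by positivity) ?_
          exact_mod_cast le_max_left k m.succPNat
        have hnorm : ‖(1 - 1 / ((m : ℝ) + 1)) • b j‖ ≤ (1 - 1 / ((m : ℝ) + 1)) * r := by
          rw [norm_smul, Real.norm_of_nonneg (by linarith)]
          exact mul_le_mul_of_nonneg_left (hb j) (by linarith)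
        refine ⟨⟨(1 - 1 / ((m : ℝ) + 1)) • b j, hnorm.trans (by nlinarith)⟩, ?_, ?_⟩
        · have : (1 - 1 / ((m : ℝ) + 1)) • b j - b j = -((1 / ((m : ℝ) + 1)) • b j) := by
            rw [sub_smul, one_smul]; abel
          rw [this, norm_neg, norm_smul, Real.norm_of_nonneg hs0.le, mul_comm]
          exact mul_le_mul_of_nonneg_right (hb j) hs0.le
        · refine sat_approx_mono _ (le_max_right k m.succPNat) _ _ (hj _ (hnorm.trans ?_))
          push_cast at hkm ⊢
          linarith
      have hcb : ofFamily (.of (fun j => (c j).1) ⟨r, fun j => (c j).2⟩) = ofFamily b :=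
        ofFamily_eq_iff.mpr <| tendsto_norm_sub_zero_of_forall_exists_ge fun M =>
          (hc M).mono fun j ⟨m, hm, hj, _⟩ => ⟨m, hm, hj⟩
      rw [← hcb, ← cls_update, ih hφ.2]
      refine .of_forall_exists_ge fun M => (hc M).mono fun j ⟨m, hm, _, hj⟩ => ⟨m, hm, ?_⟩
      rwa [coord_update]

end PBFormula

end Los

/-! ### Branches of the tree of approximations -/

section Branches

variable {Ω : NSSignature.{u, v}}

open NSStructure.Family

/-- A sequence of pairs `(h, m)` that satisfy `P` and among which every branch has a companion that
cannot be distinguished from it by the approximation in question.  It exists since there are only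
countably many approximations. -/
theorem PBFormula.exists_covering_sequence [Countable Ω.Fun] [Countable Ω.Rel] {I : Type*}
    [Nonempty I] (form : I → PBFormula Ω) {P : I → ℕ+ → Prop} (hP : ∀ h, ∃ m, P h m) :
    ∃ f : ℕ → I × ℕ+, (∀ s, P (f s).1 (f s).2) ∧
      ∀ h, ∃ s, (form h).approx (f s).2 = (form (f s).1).approx (f s).2 := by
  let S : Set (I × ℕ+) := {p | P p.1 p.2}
  let g : I × ℕ+ → PBFormula Ω × ℕ+ := fun p => ((form p.1).approx p.2, p.2)
  have hcount : (g '' S).Countable := by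
    refine (PBFormula.countable_isFinitary.prod (Set.countable_univ (α := ℕ+))).mono ?_
    rintro _ ⟨p, -, rfl⟩
    exact ⟨PBFormula.isFinitary_approx _ _, trivial⟩
  have hne : (g '' S).Nonempty := by
    obtain ⟨m, hm⟩ := hP (Classical.arbitrary I)
    exact ⟨_, (_, m), hm, rfl⟩
  obtain ⟨e, he⟩ := hcount.exists_eq_range hne
  have hmem : ∀ s, ∃ p ∈ S, g p = e s := fun s => by
    have : e s ∈ g '' S := he ▸ Set.mem_range_self s
    exact this
  choose f hfS hf using hmem
  refine ⟨f, hfS, fun h => ?_⟩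
  obtain ⟨m, hm⟩ := hP h
  have : g (h, m) ∈ Set.range e := he ▸ ⟨(h, m), hm, rfl⟩
  obtain ⟨s, hs⟩ := this
  rw [← hf s] at hs
  obtain ⟨h1, h2⟩ := Prod.mk.inj hs
  have h2 : (f s).2 = m := h2
  exact ⟨s, by rw [h1, h2]⟩

namespace LAFormula

theorem nonempty_tree_I [Countable Ω.Fun] [Countable Ω.Rel] (φ : LAFormula Ω) :
    Nonempty φ.tree.I := by
  induction φ with
  | ofPB φ hφ => exact ⟨()⟩
  | finAnd m φ ih => exact ⟨fun i => (ih i).some⟩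
  | iAnd φ ih => exact ⟨fun i => (ih i).some⟩
  | not φ ih =>
    obtain ⟨f, -, hf⟩ := PBFormula.exists_covering_sequence φ.tree.form (P := fun _ _ => True)
      fun h => ⟨1, trivial⟩
    exact ⟨⟨f, hf⟩⟩
  | ex y r φ ih => exact ih

theorem freeVars_form_subset (φ : LAFormula Ω) (h : φ.tree.I) :
    (φ.tree.form h).freeVars ⊆ φ.freeVars := by
  induction φ with
  | ofPB φ hφ => exact subset_rfl
  | finAnd m φ ih =>
    exact (PBFormula.freeVars_finAnd _ _).trans_subset (Set.iUnion_mono fun i => ih i (h i))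
  | iAnd φ ih => exact Set.iUnion_mono fun i => ih i (h i)
  | not φ ih =>
    exact Set.iUnion_subset fun s => (PBFormula.freeVars_neg_subset _ _).trans (ih (h.1 s).1)
  | ex y r φ ih =>
    refine Set.iUnion_subset fun n x hx => ?_
    obtain ⟨hx, hne⟩ := PBFormula.mem_freeVars_exBlock hx
    refine ⟨ih h (PBFormula.freeVars_approx_subset _ _ hx), ?_⟩
    rintro ⟨i, rfl⟩
    exact hne i (PBFormula.lt_ind_approx y _ _ i hx) rfl

variable {U : Ultrafilter ℕ} {F : ℕ → NSStructure.{u, v, w} Ω}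

theorem _root_.NSStructure.Family.coord_extend (y : ℕ → ℕ) (b a : ℕ → NSStructure.Family U F)
    (j : ℕ) :
    coord (Function.extend y b a) j = Function.extend y (fun i => b i j) (coord a j) :=
  funext fun x => Function.apply_extend (fun z : NSStructure.Family U F => z j) y a x

theorem _root_.NSStructure.Family.cls_extend (y : ℕ → ℕ) (b a : ℕ → NSStructure.Family U F) :
    cls (Function.extend y b a) = Function.extend y (fun i => ofFamily (b i)) (cls a) :=
  funext fun x => Function.apply_extend ofFamily y a x

/-- The step for the infinite existential quantifier: witnesses for the quantifier blocks of all
approximations combine to a single sequence of bounded families, and conversely. -/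
theorem approxSat_iAnd_exBlock_iff (hU : (U : Filter ℕ) ≤ atTop) (y : ℕ ↪ ℕ) (r : ℕ → ℚ≥0)
    (χ : PBFormula Ω) (a : ℕ → NSStructure.Family U F) :
    (PBFormula.iAnd fun n => PBFormula.exBlock y (fun i => (r i : ℚ))
      ((χ.approx n.succPNat).ind y) (χ.approx n.succPNat)).ApproxSat a ↔
    ∃ b : ℕ → NSStructure.Family U F, (∀ i, ‖ofFamily (b i)‖ ≤ ((r i : ℚ) : ℝ)) ∧
      χ.ApproxSat (Function.extend y b a) := by
  classical
  rw [PBFormula.approxSat_iAnd]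
  constructor
  · intro h
    have hr : ∀ i, (0 : ℝ) ≤ ((r i : ℚ) : ℝ) := fun i => by positivity
    let X (j : ℕ) : Type w := {b : ℕ → (F j).carrier // ∀ i, ‖b i‖ ≤ ((r i : ℚ) : ℝ) + 1}
    have : ∀ j, Nonempty (X j) := fun j =>
      ⟨fun _ => 0, fun i => by rw [norm_zero]; exact add_nonneg (hr i) zero_le_one⟩
    obtain ⟨b, hb⟩ := Ultrafilter.exists_diagonal hU (X := X)
      (fun m j b => (∀ i, ‖b.1 i‖ ≤ (((r i : ℚ) + 1 / (m.succPNat : ℚ) : ℚ) : ℝ)) ∧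
        ((χ.approx m.succPNat).approx m.succPNat).Sat (F j)
          (Function.extend y b.1 (coord a j))) <| by
      intro m
      filter_upwards [h m m.succPNat] with j hj
      rw [PBFormula.approx_exBlock, PBFormula.sat_exBlock] at hj
      obtain ⟨c, hca, hcr, hc⟩ := hj
      have hb : ∀ i, ‖if i < (χ.approx m.succPNat).ind y then c (y i) else 0‖ ≤
          (((r i : ℚ) + 1 / (m.succPNat : ℚ) : ℚ) : ℝ) := by
        intro i
        split_ifs with hi
        · exact hcr i hi
        · rw [norm_zero]
          exact_mod_cast (by positivity : (0 : ℚ) ≤ (r i : ℚ) + 1 / (m.succPNat : ℚ))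
      refine ⟨⟨fun i => if i < (χ.approx m.succPNat).ind y then c (y i) else 0, fun i =>
        (hb i).trans (Rat.cast_add_one_div_le_add_one _ _)⟩, hb, ?_⟩
      · refine (PBFormula.sat_congr _ _ fun x hx => ?_).mp hc
        by_cases hxy : ∃ i, y i = x
        · obtain ⟨i, rfl⟩ := hxy
          rw [y.injective.extend_apply]
          exact (if_pos (PBFormula.lt_ind_approx y _ _ i
            (PBFormula.freeVars_approx_subset _ _ hx))).symm
        · rw [Function.extend_apply' _ _ _ hxy]
          exact hca x fun i _ hxi => hxy ⟨i, hxi.symm⟩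
    refine ⟨fun i => .of (fun j => (b j).1 i) ⟨r i + 1, fun j => (b j).2 i⟩, fun i => ?_, ?_⟩
    · refine ((NormedUltraproduct.tendsto_norm _).le_rat_iff _).mpr fun k => ?_
      filter_upwards [hb k] with j hj
      obtain ⟨m, hm, hj, -⟩ := hj
      exact (hj i).trans (Rat.cast_add_one_div_le_of_le _
        (PNat.coe_le_coe _ _ |>.mp (by simpa using hm.le.trans m.le_succ)))
    · intro k
      filter_upwards [hb (2 * k)] with j hj
      obtain ⟨m, hm, -, hj⟩ := hj
      rw [coord_extend]
      refine PBFormula.sat_approx_of_sat_approx_approx _ ?_ _ _ hj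
      have hm' : 2 * (k : ℚ) ≤ m := by exact_mod_cast hm
      have hk : (0 : ℚ) < k := by positivity
      rw [← add_div, div_le_div_iff₀ (by positivity) hk]
      simp only [Nat.succPNat_coe, Nat.cast_succ]
      linarith
  · rintro ⟨b, hbr, hb⟩ n
    intro m
    have hnorm : ∀ i < (χ.approx n.succPNat).ind y, ∀ᶠ j in (U : Filter ℕ),
        ‖b i j‖ ≤ (((r i : ℚ) + 1 / (m : ℚ) : ℚ) : ℝ) := fun i _ =>
      ((NormedUltraproduct.tendsto_norm (b i)).le_rat_iff _).mp (hbr i) m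
    filter_upwards [hb n.succPNat, (Set.finite_lt_nat _).eventually_all.mpr hnorm] with j hj hjr
    rw [PBFormula.approx_exBlock, PBFormula.sat_exBlock]
    rw [coord_extend] at hj
    refine ⟨fun x => if ∃ i < (χ.approx n.succPNat).ind y, x = y i then
        Function.extend y (fun i => b i j) (coord a j) x else coord a j x, fun x hx => ?_,
      fun i hi => ?_, PBFormula.sat_approx_of_sat _ _ _ _
        ((PBFormula.sat_congr _ _ fun x hx => ?_).mp hj)⟩
    · exact if_neg fun ⟨i, hi, hxi⟩ => hx i hi hxi
    · simp only [if_pos (⟨i, hi, rfl⟩ : ∃ i' < (χ.approx n.succPNat).ind y, y i = y i')]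
      rw [y.injective.extend_apply]
      exact hjr i hi
    · by_cases hxy : ∃ i, y i = x
      · obtain ⟨i, rfl⟩ := hxy
        exact (if_pos ⟨i, PBFormula.lt_ind_approx y _ _ i hx, rfl⟩).symm
      · rw [if_neg fun ⟨i, _, hxi⟩ => hxy ⟨i, hxi.symm⟩, Function.extend_apply' _ _ _ hxy]

/-- A formula of `L_A` is true in the ultraproduct if and only if, for some branch of its tree of
approximations, the positive bounded formula on that branch is approximately true in the factors. -/
theorem sat_ultraproduct_iff_exists_branch [Countable Ω.Fun] [Countable Ω.Rel]
    (hU : (U : Filter ℕ) ≤ atTop) (φ : LAFormula Ω) (a : ℕ → NSStructure.Family U F) :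
    φ.Sat (NSStructure.ultraproduct U F) (cls a) ↔
      ∃ h : φ.tree.I, (φ.tree.form h).ApproxSat a := by
  induction φ generalizing a with
  | ofPB φ hφ =>
    exact (PBFormula.sat_ultraproduct_iff hU φ hφ a).trans ⟨fun h => ⟨(), h⟩, fun ⟨_, h⟩ => h⟩
  | finAnd m φ ih =>
    refine (forall_congr' fun i => ih i a).trans (Classical.skolem.trans ?_)
    exact exists_congr fun h => PBFormula.approxSat_finAnd.symm
  | iAnd φ ih =>
    refine (forall_congr' fun i => ih i a).trans (Classical.skolem.trans ?_)
    exact exists_congr fun h => PBFormula.approxSat_iAnd.symm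
  | not φ ih =>
    refine (not_congr (ih a)).trans ⟨fun hne => ?_, ?_⟩
    · have := φ.nonempty_tree_I
      have hneg : ∀ h, ∃ m, ((φ.tree.form h).neg m).ApproxSat a := by
        intro h
        obtain ⟨m, hm⟩ := not_forall.mp (not_exists.mp hne h)
        exact ⟨m, PBFormula.approxSat_of_eventually_sat <|
          (Ultrafilter.eventually_not.mpr hm).mono fun j hj =>
            PBFormula.sat_neg_of_not_sat_approx _ _ _ _ hj⟩
      obtain ⟨f, hf, hcover⟩ := PBFormula.exists_covering_sequence φ.tree.form hneg
      exact ⟨⟨f, hcover⟩, PBFormula.approxSat_iAnd.mpr hf⟩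
    · rintro ⟨f, hf⟩ ⟨h, hh⟩
      obtain ⟨s, hs⟩ := f.2 h
      have hneg := PBFormula.approxSat_iAnd.mp hf s
      rw [← PBFormula.dual_approx, ← hs, PBFormula.dual_approx] at hneg
      obtain ⟨j, hj, hj'⟩ :=
        ((hh (2 * (f.1 s).2 + 1)).and (hneg (2 * (f.1 s).2 + 1))).exists
      exact PBFormula.not_sat_approx_neg _ (PNat.lt_add_right _ _) _ _ hj hj'
  | ex y r φ ih =>
    have hcls : (ex y r φ).Sat (NSStructure.ultraproduct U F) (cls a) ↔
        ∃ b : ℕ → NSStructure.Family U F, (∀ i, ‖ofFamily (b i)‖ ≤ ((r i : ℚ) : ℝ)) ∧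
          φ.Sat (NSStructure.ultraproduct U F) (cls (Function.extend y b a)) := by
      constructor
      · rintro ⟨e, he, h⟩
        obtain ⟨b, rfl⟩ : ∃ b : ℕ → NSStructure.Family U F, (fun i => ofFamily (b i)) = e :=
          ⟨fun i => rep (e i), funext fun i => ofFamily_rep _⟩
        exact ⟨b, he, by rwa [cls_extend]⟩
      · rintro ⟨b, hb, h⟩
        exact ⟨fun i => ofFamily (b i), hb, by rwa [cls_extend] at h⟩
    rw [hcls]
    simp only [ih]
    refine Iff.trans ?_ (exists_congr fun h => (approxSat_iAnd_exBlock_iff hU y r _ a).symm)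
    exact ⟨fun ⟨b, hb, h, hh⟩ => ⟨h, b, hb, hh⟩, fun ⟨h, b, hb, hh⟩ => ⟨b, hb, h, hh⟩⟩

end LAFormula

end Branches

theorem mainTheorem1 (Ω : NSSignature.{u, v}) [Countable Ω.Fun] [Countable Ω.Rel]
    (Γ : Set (PBFormula Ω)) (hΓ : ∀ σ ∈ Γ, σ.freeVars = ∅)
    (φ : LAFormula Ω) (hφ : (LAFormula.not φ).freeVars = ∅)
    (hmodels : ∀ E : NSStructure.{u, v, w} Ω, E.IsModel Γ →
      ∀ a : ℕ → E.carrier, (LAFormula.not φ).Sat E a)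
    (h : φ.Branch) :
    ∃ n : ℕ+, ∀ E : NSStructure.{u, v, w} Ω, E.IsModel Γ →
      ∀ a : ℕ → E.carrier, ¬ ((φ.atBranch h).approx n).Sat E a := by
  by_contra! hne
  choose E hE a ha using hne
  let U : Ultrafilter ℕ := hyperfilter ℕ
  have hU : (U : Filter ℕ) ≤ atTop := Nat.hyperfilter_le_atTop
  let F : ℕ → NSStructure.{u, v, w} Ω := fun j => E j.succPNat
  have hmodel : (NSStructure.ultraproduct U F).IsModel Γ := by
    intro σ hσ e
    rw [PBFormula.sat_congr _ (b := NSStructure.Family.cls (0 : ℕ → NSStructure.Family U F)) σ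
      (by simp [hΓ σ hσ])]
    exact PBFormula.sat_ultraproduct_of_eventually_sat σ _ (.of_forall fun j => hE _ σ hσ _)
  refine hmodels _ hmodel (NSStructure.Family.cls (0 : ℕ → NSStructure.Family U F))
    ((φ.sat_ultraproduct_iff_exists_branch hU _).mpr ⟨h, fun m => ?_⟩)
  filter_upwards [hU (eventually_ge_atTop (m : ℕ))] with j hj
  -- the assignments `a n` need not be bounded, but a sentence does not depend on them
  have hfree : ((φ.atBranch h).approx j.succPNat).freeVars = ∅ :=
    Set.subset_eq_empty (((φ.atBranch h).freeVars_approx_subset _).trans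
      (φ.freeVars_form_subset h)) hφ
  have hsat : ((φ.atBranch h).approx j.succPNat).Sat (F j)
      (NSStructure.Family.coord (0 : ℕ → NSStructure.Family U F) j) :=
    (PBFormula.sat_congr _ _ fun x hx => by simp [hfree] at hx).mp (ha j.succPNat)
  exact PBFormula.sat_approx_mono _
    (PNat.coe_le_coe _ _ |>.mp (by simpa using hj.trans j.le_succ)) _ _ hsat
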